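/- Let $X$ be a complex Banach space. A (possibly unbounded) linear operator $A$ on $X$ generates a bounded analytic semigroup if there are $\theta\in(0,\pi/2]$ and a family $(S(z))_{z\in\Sigma_\theta\cup\{0\}}$ of bounded operators on $X$, where $\Sigma_\theta=\{z\in\mathbb C\setminus\{0\}:|\arg z|<\theta\}$, such that $S(0)=I$, $S(z+w)=S(z)S(w)$ for $z,w\in\Sigma_\theta$, $z\mapsto S(z)$ is holomorphic on $\Sigma_\theta$, $S(z)x\to x$ as $z\to 0$ in $\Sigma_\theta$ for every $x\in X$, $\sup_{z\in\Sigma_\theta}\|S(z)\|<\infty$, and $A$ is the infinitesimal generator of $(S(t))_{t\ge 0}$. For $1<p<\infty$ and $0<T<\infty$, an operator $B$ on $X$ satisfies $L^p$-maximal regularity on $[0,T)$ if the operator $u\mapsto u'+Bu$ on $L^p([0,T);X)$, with domain $\{u\in W^{1,p}([0,T);X): u(0)=0\}\cap L^p([0,T);D(B))$, is a bijection onto $L^p([0,T);X)$ with bounded inverse. The operator $B$ satisfies maximal regularity if it satisfies $L^p$-maximal regularity on $[0,T)$ for some $1<p<\infty$ and some $0<T<\infty$ (when $-B$ generates a bounded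 analytic semigroup this is known to be equivalent to all such $p$ and $T$). The space $X$ has the maximal regularity property if every $B$ such that $-B$ generates a bounded analytic semigroup on $X$ satisfies maximal regularity. Then neither of the complex sequence spaces $c_0$ and $\ell_1$ has the maximal regularity property; that is, on each of them there is an operator $B$ such that $-B$ generates a bounded analytic semigroup and $B$ fails $L^p$-maximal regularity on $[0,T)$ for all $1<p<\infty$ and all $0<T<\infty$. -/

import Mathlib

open MeasureTheory Filter Topology Set
open scoped ENNReal ZeroAtInfty

namespace MaximalRegularity

variable {X : Type*} [NormedAddCommGroup X] [NormedSpace ℂ X]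

/-- The open sector `{z ≠ 0 : |arg z| < θ}` of the complex plane. -/
def sector (θ : ℝ) : Set ℂ := {z | z ≠ 0 ∧ |z.arg| < θ}

/-- `S` is an analytic semigroup on the sector of half-angle `θ ∈ (0, π/2]`, strongly continuous
at `0` and uniformly bounded on that sector. (The values of `S` off `sector θ ∪ {0}` play no
role.) -/
structure IsBoundedAnalyticSemigroup (θ : ℝ) (S : ℂ → X →L[ℂ] X) : Prop where
  angle_pos : 0 < θ
  angle_le : θ ≤ Real.pi / 2
  map_zero : S 0 = ContinuousLinearMap.id ℂ X
  map_add : ∀ z ∈ sector θ, ∀ w ∈ sector θ, S (z + w) = (S z).comp (S w)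
  analytic : DifferentiableOn ℂ S (sector θ)
  strongly_continuous : ∀ x : X, Tendsto (fun z => S z x) (𝓝[sector θ] 0) (𝓝 x)
  bounded : ∃ M : ℝ, ∀ z ∈ sector θ, ‖S z‖ ≤ M

/-- `A` is the infinitesimal generator of `(S t)_{t ≥ 0}`: its graph consists of exactly the pairs
`(x, y)` with `(S t x - x) / t → y` as `t → 0+`. -/
def IsGenerator (A : X →ₗ.[ℂ] X) (S : ℂ → X →L[ℂ] X) : Prop :=
  ∀ x y : X, (x, y) ∈ A.graph ↔
    Tendsto (fun t : ℝ => (t : ℂ)⁻¹ • (S (t : ℂ) x - x)) (𝓝[>] (0 : ℝ)) (𝓝 y)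

/-- `A` generates a bounded analytic semigroup on `X`. -/
def GeneratesBoundedAnalyticSemigroup (A : X →ₗ.[ℂ] X) : Prop :=
  ∃ (θ : ℝ) (S : ℂ → X →L[ℂ] X), IsBoundedAnalyticSemigroup θ S ∧ IsGenerator A S

/-- The space `L^p([0,T); X)`. -/
abbrev LpTime (X : Type*) [NormedAddCommGroup X] (p : ℝ≥0∞) (T : ℝ) : Type _ :=
  Lp X p (volume.restrict (Ico (0 : ℝ) T))

/-- `u ∈ W^{1,p}([0,T); X)` with `u(0) = 0` and `u' = v ∈ L^p([0,T); X)`, that is,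
`u(t) = ∫_0^t v(s) ds` for almost every `t`. -/
def HasDerivZero {p : ℝ≥0∞} {T : ℝ} (u v : LpTime X p T) : Prop :=
  ∀ᵐ t ∂(volume.restrict (Ico (0 : ℝ) T)), u t = ∫ s in (0 : ℝ)..t, v s

/-- `u ∈ L^p([0,T); D(B))` and `w(t) = B(u(t))` almost everywhere, with `w ∈ L^p([0,T); X)`. -/
def HasImage (B : X →ₗ.[ℂ] X) {p : ℝ≥0∞} {T : ℝ} (u w : LpTime X p T) : Prop :=
  ∀ᵐ t ∂(volume.restrict (Ico (0 : ℝ) T)), (u t, w t) ∈ B.graph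

/-- `u` lies in the domain of `d/dt + B` on `L^p([0,T); X)`, that is, in
`W_0^{1,p}([0,T); X) ∩ L^p([0,T); D(B))`, and `u' + B u = f`. -/
def SolvesCauchy (B : X →ₗ.[ℂ] X) {p : ℝ≥0∞} {T : ℝ} (u f : LpTime X p T) : Prop :=
  ∃ v w : LpTime X p T, HasDerivZero u v ∧ HasImage B u w ∧ v + w = f

/-- `L^p`-maximal regularity of `B` on `[0,T)`: the operator `d/dt + B` with domain
`W_0^{1,p}([0,T); X) ∩ L^p([0,T); D(B))` is a bijection onto `L^p([0,T); X)` and its inverse is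
bounded on `L^p([0,T); X)`. -/
def HasLpMaximalRegularity (B : X →ₗ.[ℂ] X) (p : ℝ≥0∞) (T : ℝ) : Prop :=
  (∀ f : LpTime X p T, ∃! u : LpTime X p T, SolvesCauchy B u f) ∧
    ∃ C : ℝ, ∀ u f : LpTime X p T, SolvesCauchy B u f → ‖u‖ ≤ C * ‖f‖

/-- (MR): `L^p`-maximal regularity on `[0,T)` for some `1 < p < ∞` and some `0 < T < ∞`. For
negative generators of bounded analytic semigroups this is the same as for all such `p` and `T`;
the form with "some" makes the failure of (MR) a statement about all `p` and `T`. -/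
def HasMaximalRegularity (B : X →ₗ.[ℂ] X) : Prop :=
  ∃ (p : ℝ≥0∞) (T : ℝ), 1 < p ∧ p < ∞ ∧ 0 < T ∧ HasLpMaximalRegularity B p T

/-- (MRP) for a complex Banach space `X`: every `B` such that `-B` generates a bounded analytic
semigroup on `X` satisfies (MR). -/
def MaximalRegularityProperty (X : Type*) [NormedAddCommGroup X] [NormedSpace ℂ X]
    [CompleteSpace X] : Prop :=
  ∀ B : X →ₗ.[ℂ] X, GeneratesBoundedAnalyticSemigroup (-B) → HasMaximalRegularity B

end MaximalRegularity

/-!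
Both spaces carry a conditional Schauder basis: the summing basis of `c₀` and the difference basis
of `ℓ¹`. Sequences of bounded variation are multipliers of any basis, so a diagonal operator with
positive increasing eigenvalues `λ_n → ∞` generates, up to sign, a bounded analytic semigroup. If
`u' + B u = f` and `u 0 = 0`, then the `n`-th coordinate of `B u` is the relaxation
`λ_n ∫₀ᵗ exp (-λ_n (t - s)) f_n s ds`, a low-pass filter with cutoff frequency `λ_n`.

The entries of `f` are built from Riesz products whose lacunary frequencies `ω_k` interlace with
the `λ_n`, so that relaxation acts almost as a sharp cutoff. Because the basis is conditional, `f`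
can be bounded while `B u (t) ∈ X` forces `∑ β_k sin² (ω_k t) < ∞` for weights `β_k ≥ 0` with
`∑ β_k = ∞`. By a Cantor–Lebesgue argument this fails for almost every `t`.
-/

namespace MaximalRegularity

section Multipliers

variable {𝕜 : Type*} [NontriviallyNormedField 𝕜]

/-- A null sequence of bounded variation at most `V`: the multipliers of an arbitrary, possibly
conditional, Schauder basis. -/
structure IsBVNull (m : ℕ → 𝕜) (V : ℝ) : Prop where
  tendsto_zero : Tendsto m atTop (𝓝 0)
  summable : Summable fun n => ‖m n - m (n + 1)‖
  tsum_le : ∑' n, ‖m n - m (n + 1)‖ ≤ V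

theorem IsBVNull.mono {m : ℕ → 𝕜} {V W : ℝ} (hm : IsBVNull m V) (hVW : V ≤ W) : IsBVNull m W :=
  ⟨hm.tendsto_zero, hm.summable, hm.tsum_le.trans hVW⟩

theorem hasSum_sub_succ {g : ℕ → ℝ} (hg : Antitone g) (hg0 : Tendsto g atTop (𝓝 0)) :
    HasSum (fun n => g n - g (n + 1)) (g 0) := by
  rw [hasSum_iff_tendsto_nat_of_nonneg fun n => sub_nonneg.mpr (hg n.le_succ)]
  simp_rw [Finset.sum_range_sub']
  simpa using hg0.const_sub (g 0)

theorem IsBVNull.of_norm_sub_le {m : ℕ → 𝕜} {g : ℕ → ℝ} {V : ℝ} (hm : Tendsto m atTop (𝓝 0))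
    (hg : Antitone g) (hg0 : Tendsto g atTop (𝓝 0))
    (h : ∀ n, ‖m n - m (n + 1)‖ ≤ V * (g n - g (n + 1))) : IsBVNull m (V * g 0) := by
  have hs := (hasSum_sub_succ hg hg0).mul_left V
  have hsum : Summable fun n => ‖m n - m (n + 1)‖ := hs.summable.of_norm_bounded (by simpa using h)
  exact ⟨hm, hsum, hsum.tsum_le_of_sum_le fun s => by
    exact (Finset.sum_le_sum fun n _ => h n).trans
      (sum_le_hasSum s (fun n _ => (norm_nonneg _).trans (h n)) hs)⟩

variable {X : Type*} [NormedAddCommGroup X] [NormedSpace 𝕜 X] (b : SchauderBasis 𝕜 X)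

theorem eq_of_coord_eq {x y : X} (h : ∀ k, b.coord k x = b.coord k y) : x = y :=
  (b.expansion x).unique (by simpa only [h] using b.expansion y)

theorem coord_proj (k n : ℕ) (x : X) :
    b.coord k (SchauderBasis.proj b n x) = if k < n then b.coord k x else 0 := by
  simp [b.ortho, Pi.single_apply]

/-- A uniformly bounded family of operators that converges to the identity on a Schauder basis
converges strongly to the identity. -/
theorem tendsto_apply_of_tendsto_basis {ι : Type*} {l : Filter ι} {S : ι → X →L[𝕜] X} {M : ℝ}
    (hM : ∀ᶠ i in l, ‖S i‖ ≤ M) (hS : ∀ k, Tendsto (fun i => S i (b k)) l (𝓝 (b k))) (x : X) :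
    Tendsto (fun i => S i x) l (𝓝 x) := by
  have hproj : ∀ n, Tendsto (fun i => S i (SchauderBasis.proj b n x)) l
      (𝓝 (SchauderBasis.proj b n x)) := fun n => by
    simp only [SchauderBasis.proj_apply, map_sum, map_smul]
    exact tendsto_finsetSum _ fun k _ => (hS k).const_smul _
  rw [Metric.tendsto_nhds]
  intro ε hε
  have herr : Tendsto (fun n => M * ‖x - SchauderBasis.proj b n x‖ + ‖x - SchauderBasis.proj b n x‖)
      atTop (𝓝 0) := by
    have hx := ((SchauderBasis.tendsto_proj b x).const_sub x).norm
    rw [sub_self, norm_zero] at hx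
    simpa only [mul_zero, add_zero] using (hx.const_mul M).add hx
  obtain ⟨n, hn⟩ := (herr.eventually (gt_mem_nhds (half_pos hε))).exists
  filter_upwards [hM, Metric.tendsto_nhds.mp (hproj n) (ε / 2) (half_pos hε)] with i hi hin
  set p := SchauderBasis.proj b n x
  have hxp : dist (S i x) (S i p) ≤ M * ‖x - p‖ := by
    rw [dist_eq_norm, ← map_sub]
    exact (S i).le_of_opNorm_le hi _
  have hpx : dist p x = ‖x - p‖ := by rw [dist_comm, dist_eq_norm]
  linarith [dist_triangle4 (S i x) (S i p) p x]

/-- The operator acting as multiplication by `m k` on the `k`-th coordinate of a Schauder basis.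
It is written through summation by parts, since `∑ m k • coord k x • b k` need not converge in
operator norm. -/
noncomputable def multiplier (m : ℕ → 𝕜) : X →L[𝕜] X :=
  ∑' n, (m n - m (n + 1)) • SchauderBasis.proj b (n + 1)

variable [CompleteSpace X]

theorem norm_smul_proj_le (c : 𝕜) (n : ℕ) :
    ‖c • SchauderBasis.proj b n‖ ≤ ‖c‖ * SchauderBasis.nnnormProjBound b := by
  rw [norm_smul]
  gcongr
  exact SchauderBasis.norm_proj_le_nnnormProjBound b n

variable {m : ℕ → 𝕜} {V : ℝ} (hm : IsBVNull m V)
include hm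

theorem norm_multiplier_le : ‖multiplier b m‖ ≤ V * SchauderBasis.nnnormProjBound b := by
  refine (tsum_of_norm_bounded (hm.summable.mul_right _).hasSum
    fun n => norm_smul_proj_le b _ _).trans ?_
  rw [tsum_mul_right]
  gcongr
  exact hm.tsum_le

theorem coord_multiplier (k : ℕ) (x : X) :
    b.coord k (multiplier b m x) = m k * b.coord k x := by
  have hop : HasSum (fun n => (m n - m (n + 1)) • SchauderBasis.proj b (n + 1))
      (multiplier b m) :=
    (Summable.of_norm_bounded (hm.summable.mul_right _) fun n => norm_smul_proj_le b _ _).hasSum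
  have hsum : HasSum (fun n => (m n - m (n + 1)) * b.coord k (SchauderBasis.proj b (n + 1) x))
      (b.coord k (multiplier b m x)) := by
    simpa only [ContinuousLinearMap.apply_apply, smul_apply, map_smul, smul_eq_mul]
      using (hop.mapL (ContinuousLinearMap.apply 𝕜 X x)).mapL (b.coord k)
  have hpartial : ∀ N, ∑ n ∈ Finset.range (k + N),
      (m n - m (n + 1)) * b.coord k (SchauderBasis.proj b (n + 1) x)
        = (m k - m (k + N)) * b.coord k x := fun N => by
    have hlow : ∀ n ∈ Finset.range k,
        (m n - m (n + 1)) * b.coord k (SchauderBasis.proj b (n + 1) x) = 0 := fun n hn => by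
      rw [coord_proj, if_neg (by have := Finset.mem_range.mp hn; omega), mul_zero]
    have hhigh : ∀ n, b.coord k (SchauderBasis.proj b (k + n + 1) x) = b.coord k x := fun n => by
      rw [coord_proj, if_pos (by omega)]
    rw [Finset.sum_range_add, Finset.sum_eq_zero hlow, zero_add]
    simp_rw [hhigh, ← Finset.sum_mul, add_assoc]
    rw [Finset.sum_range_sub' (fun n => m (k + n)), add_zero]
  have hlim : Tendsto (fun N => (m k - m (k + N)) * b.coord k x) atTop
      (𝓝 (m k * b.coord k x)) := by
    have hmk : Tendsto (fun N => m (k + N)) atTop (𝓝 0) := by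
      simpa only [add_comm k] using (tendsto_add_atTop_iff_nat k).mpr hm.tendsto_zero
    simpa using (hmk.const_sub (m k)).mul_const (b.coord k x)
  refine tendsto_nhds_unique (hsum.tendsto_sum_nat.comp (tendsto_add_atTop_nat k)) (hlim.congr ?_)
  intro N
  simp only [Function.comp_apply, add_comm N k, hpartial]

theorem multiplier_basis (k : ℕ) : multiplier b m (b k) = m k • b k :=
  eq_of_coord_eq b fun j => by
    rw [coord_multiplier b hm, map_smul, smul_eq_mul]
    rcases eq_or_ne j k with rfl | hjk
    · rfl
    · simp [b.ortho, hjk]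

end Multipliers

section DiagonalSemigroup

theorem norm_cexp_neg_ofReal_mul (s : ℝ) (z : ℂ) :
    ‖Complex.exp (-(s * z))‖ = Real.exp (-(s * z.re)) := by
  simp [Complex.norm_exp]

theorem norm_cexp_sub_cexp_le {z : ℂ} {δ a b : ℝ} (hδ : 0 < δ) (hz : δ ≤ z.re) (ha : 0 ≤ a)
    (hab : a ≤ b) :
    ‖Complex.exp (-(a * z)) - Complex.exp (-(b * z))‖ ≤
      ‖z‖ / δ * (Real.exp (-(a * δ)) - Real.exp (-(b * δ))) := by
  have hf : ∀ s : ℝ, HasDerivAt (fun s : ℝ => Complex.exp (-(a * z)) - Complex.exp (-(s * z)))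
      (z * Complex.exp (-(s * z))) s := fun s => by
    convert! (((Complex.ofRealCLM.hasDerivAt (x := s)).mul_const z).neg.cexp).const_sub
      (Complex.exp (-(a * z))) using 1
    simp [mul_comm]
  have hB : ∀ s : ℝ, HasDerivAt
      (fun s : ℝ => ‖z‖ / δ * (Real.exp (-(a * δ)) - Real.exp (-(s * δ))))
      (‖z‖ * Real.exp (-(s * δ))) s := fun s => by
    have hneg : HasDerivAt (fun s : ℝ => -(s * δ)) (-δ) s := (hasDerivAt_mul_const δ).neg
    convert! (hneg.exp.const_sub (Real.exp (-(a * δ)))).const_mul (‖z‖ / δ) using 1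
    field_simp
  refine image_norm_le_of_norm_deriv_right_le_deriv_boundary
    (fun s _ => (hf s).continuousAt.continuousWithinAt) (fun s _ => (hf s).hasDerivWithinAt)
    (by simp) hB (fun s hs => ?_) (right_mem_Icc.mpr hab)
  rw [norm_mul, norm_cexp_neg_ofReal_mul]
  have := ha.trans hs.1
  gcongr

theorem norm_le_two_mul_re_of_mem_sector {z : ℂ} (hz : z ∈ sector (Real.pi / 4)) :
    ‖z‖ ≤ 2 * z.re := by
  have hcos : √2 / 2 ≤ z.re / ‖z‖ := by
    rw [← Real.cos_pi_div_four, ← Complex.cos_arg hz.1, ← Real.cos_abs z.arg]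
    exact Real.cos_le_cos_of_nonneg_of_le_pi (abs_nonneg _) (by linarith [Real.pi_pos]) hz.2.le
  have hsqrt : (1 : ℝ) ≤ √2 := Real.one_le_sqrt.mpr one_le_two
  rw [le_div_iff₀ (norm_pos_iff.mpr hz.1)] at hcos
  nlinarith [norm_nonneg z]

theorem re_pos_of_mem_sector {z : ℂ} (hz : z ∈ sector (Real.pi / 4)) : 0 < z.re := by
  have := norm_pos_iff.mpr hz.1
  have := norm_le_two_mul_re_of_mem_sector hz
  linarith

/-- The mean value of `exp (-s)` over `0 ≤ s ≤ a`. -/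
noncomputable def expMean (a : ℝ) : ℝ := (1 - Real.exp (-a)) / a

theorem expMean_le_one {a : ℝ} (ha : 0 < a) : expMean a ≤ 1 := by
  rw [expMean, div_le_one ha]
  linarith [Real.add_one_le_exp (-a)]

theorem expMean_antitoneOn : AntitoneOn expMean (Ioi 0) := by
  intro a ha c hc hac
  have hneg : ∀ x, expMean x = (Real.exp (-x) - Real.exp 0) / (-x - 0) := fun x => by
    rw [Real.exp_zero, sub_zero, ← neg_div_neg_eq, neg_sub, neg_neg, expMean]
  rw [hneg, hneg]
  exact convexOn_exp.secant_mono trivial trivial trivial (neg_ne_zero.mpr hc.out.ne')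
    (neg_ne_zero.mpr ha.out.ne') (neg_le_neg hac)

theorem tendsto_expMean_atTop : Tendsto expMean atTop (𝓝 0) :=
  (Real.tendsto_exp_neg_atTop_nhds_zero.const_sub 1).div_atTop tendsto_id

theorem tendsto_expMean_zero : Tendsto expMean (𝓝[>] 0) (𝓝 1) := by
  have hd : HasDerivAt (fun a : ℝ => -Real.exp (-a)) 1 0 := by
    convert! (hasDerivAt_neg (0 : ℝ)).exp.neg using 1
    simp
  refine hd.tendsto_slope_zero_right.congr fun a => ?_
  rw [expMean, zero_add, neg_zero, Real.exp_zero, smul_eq_mul, inv_mul_eq_div, neg_sub_neg]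

theorem tendsto_expMean_mul {a : ℝ} (ha : 0 < a) :
    Tendsto (fun t => expMean (a * t)) (𝓝[>] 0) (𝓝 1) := by
  refine tendsto_expMean_zero.comp (tendsto_nhdsWithin_iff.mpr ⟨?_, ?_⟩)
  · simpa using ((continuous_const_mul a).tendsto 0).mono_left nhdsWithin_le_nhds
  · filter_upwards [self_mem_nhdsWithin] with t ht using mul_pos ha ht

/-- Admissible eigenvalues of a diagonal operator. They are monotone so that, even with respect to a
conditional basis, the semigroup acts by multipliers of bounded variation. -/
structure IsExponentSequence (lam : ℕ → ℝ) : Prop where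
  mono : Monotone lam
  pos : ∀ n, 0 < lam n
  tendsto_atTop : Tendsto lam atTop atTop

namespace IsExponentSequence

variable {lam : ℕ → ℝ} (hl : IsExponentSequence lam)
include hl

theorem antitone_exp {r : ℝ} (hr : 0 < r) : Antitone fun n => Real.exp (-(lam n * r)) :=
  fun m n hmn => by
    have := hl.mono hmn
    simp only
    gcongr

theorem tendsto_exp {r : ℝ} (hr : 0 < r) :
    Tendsto (fun n => Real.exp (-(lam n * r))) atTop (𝓝 0) :=
  Real.tendsto_exp_neg_atTop_nhds_zero.comp (hl.tendsto_atTop.atTop_mul_const hr)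

theorem isBVNull_exp {z : ℂ} (hz : 0 < z.re) :
    IsBVNull (fun n => Complex.exp (-(lam n * z))) (‖z‖ / z.re) := by
  refine (IsBVNull.of_norm_sub_le (V := ‖z‖ / z.re) ?_ (hl.antitone_exp hz) (hl.tendsto_exp hz)
    fun n => norm_cexp_sub_cexp_le hz le_rfl (hl.pos n).le (hl.mono n.le_succ)).mono ?_
  · rw [tendsto_zero_iff_norm_tendsto_zero]
    simpa only [norm_cexp_neg_ofReal_mul] using hl.tendsto_exp hz
  · have := hl.pos 0
    exact mul_le_of_le_one_right (by positivity) (Real.exp_le_one_iff.mpr (by nlinarith))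

theorem isBVNull_exp_of_mem_sector {z : ℂ} (hz : z ∈ sector (Real.pi / 4)) :
    IsBVNull (fun n => Complex.exp (-(lam n * z))) 2 :=
  (hl.isBVNull_exp (re_pos_of_mem_sector hz)).mono
    ((div_le_iff₀ (re_pos_of_mem_sector hz)).mpr (norm_le_two_mul_re_of_mem_sector hz))

theorem isBVNull_expMean {t : ℝ} (ht : 0 < t) :
    IsBVNull (fun n => (expMean (lam n * t) : ℂ)) 1 := by
  have hpos : ∀ n, 0 < lam n * t := fun n => mul_pos (hl.pos n) ht
  have hanti : Antitone fun n => expMean (lam n * t) := fun m n hmn =>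
    expMean_antitoneOn (hpos m) (hpos n) (mul_le_mul_of_nonneg_right (hl.mono hmn) ht.le)
  have hlim : Tendsto (fun n => expMean (lam n * t)) atTop (𝓝 0) :=
    tendsto_expMean_atTop.comp (hl.tendsto_atTop.atTop_mul_const ht)
  refine (IsBVNull.of_norm_sub_le (V := 1) (by exact_mod_cast hlim.ofReal) hanti hlim
    fun n => ?_).mono (by simpa using expMean_le_one (hpos 0))
  rw [← Complex.ofReal_sub, Complex.norm_real, Real.norm_of_nonneg
    (sub_nonneg.mpr (hanti n.le_succ)), one_mul]

end IsExponentSequence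

variable {X : Type*} [NormedAddCommGroup X] [NormedSpace ℂ X] (b : SchauderBasis ℂ X)
  (lam : ℕ → ℝ)

/-- The semigroup multiplying the `k`-th coordinate by `exp (-lam k z)`. Its value at `0` is set
separately, because the constant sequence `1` is not null. -/
noncomputable def diagSemigroup (z : ℂ) : X →L[ℂ] X :=
  if z = 0 then ContinuousLinearMap.id ℂ X else multiplier b fun n => Complex.exp (-(lam n * z))

/-- The graph of `diagOperator b lam`. -/
def diagGraph : Submodule ℂ (X × X) where
  carrier := {q | ∀ k, b.coord k q.2 = lam k * b.coord k q.1}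
  add_mem' hp hq k := by simp [hp k, hq k, mul_add]
  zero_mem' k := by simp
  smul_mem' c q hq k := by simp [hq k, mul_left_comm]

/-- The operator multiplying the `k`-th coordinate by `lam k`, with maximal domain. -/
noncomputable def diagOperator : X →ₗ.[ℂ] X :=
  (diagGraph b lam).toLinearPMap

variable {lam}

theorem mem_graph_diagOperator {x y : X} :
    (x, y) ∈ (diagOperator b lam).graph ↔ ∀ k, b.coord k y = lam k * b.coord k x := by
  rw [diagOperator, Submodule.toLinearPMap_graph_eq]
  · rfl
  · intro q hq hq0
    exact eq_of_coord_eq b fun k => by rw [hq k, hq0, map_zero, mul_zero]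

theorem mem_graph_neg_diagOperator {x y : X} :
    (x, y) ∈ (-diagOperator b lam).graph ↔ ∀ k, b.coord k y = -(lam k * b.coord k x) := by
  have hneg : (x, y) ∈ (-diagOperator b lam).graph ↔ (x, -y) ∈ (diagOperator b lam).graph := by
    simp [LinearPMap.neg_graph, Prod.ext_iff, neg_eq_iff_eq_neg]
  rw [hneg, mem_graph_diagOperator]
  simp only [map_neg, neg_eq_iff_eq_neg]

variable [CompleteSpace X] (hl : IsExponentSequence lam)
include hl

theorem coord_diagSemigroup {z : ℂ} (hz : 0 < z.re) (k : ℕ) (x : X) :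
    b.coord k (diagSemigroup b lam z x) = Complex.exp (-(lam k * z)) * b.coord k x := by
  have hz0 : z ≠ 0 := by rintro rfl; simp at hz
  rw [diagSemigroup, if_neg hz0, coord_multiplier b (hl.isBVNull_exp hz)]

theorem differentiableOn_diagSemigroup :
    DifferentiableOn ℂ (diagSemigroup b lam) {z | 0 < z.re} := by
  intro z hz
  obtain ⟨δ, hδ, hδz⟩ := exists_between (show 0 < z.re from hz)
  obtain ⟨R, hR⟩ := exists_gt ‖z‖
  set U : Set ℂ := {w | δ < w.re} ∩ {w | ‖w‖ < R}
  have hU : IsOpen U := (isOpen_lt continuous_const Complex.continuous_re).inter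
    (isOpen_lt continuous_norm continuous_const)
  have hsummable := (((hasSum_sub_succ (hl.antitone_exp hδ) (hl.tendsto_exp hδ)).mul_left
    (R / δ)).mul_right (SchauderBasis.nnnormProjBound b : ℝ)).summable
  have hdiff : DifferentiableOn ℂ (fun w => ∑' n,
      (Complex.exp (-(lam n * w)) - Complex.exp (-(lam (n + 1) * w))) •
        SchauderBasis.proj b (n + 1)) U := by
    refine Complex.differentiableOn_tsum_of_summable_norm hsummable (fun n => by fun_prop) hU
      fun n w hw => (norm_smul_proj_le b _ _).trans ?_
    gcongr
    refine (norm_cexp_sub_cexp_le hδ hw.1.le (hl.pos n).le (hl.mono n.le_succ)).trans ?_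
    exact mul_le_mul_of_nonneg_right (by gcongr; exact hw.2.le)
      (sub_nonneg.mpr (hl.antitone_exp hδ n.le_succ))
  have hdiff' : DifferentiableOn ℂ (diagSemigroup b lam) U := hdiff.congr fun w hw => by
    have hw0 : w ≠ 0 := by
      rintro rfl
      exact hδ.not_gt hw.1
    rw [diagSemigroup, if_neg hw0, multiplier]
  exact (hdiff'.differentiableAt (hU.mem_nhds ⟨hδz, hR⟩)).differentiableWithinAt

theorem isBoundedAnalyticSemigroup_diagSemigroup :
    IsBoundedAnalyticSemigroup (Real.pi / 4) (diagSemigroup b lam) where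
  angle_pos := by positivity
  angle_le := by linarith [Real.pi_pos]
  map_zero := if_pos rfl
  map_add z hz w hw := by
    have hz' := re_pos_of_mem_sector hz
    have hw' := re_pos_of_mem_sector hw
    ext x
    refine eq_of_coord_eq b fun k => ?_
    rw [ContinuousLinearMap.comp_apply, coord_diagSemigroup b hl (add_pos hz' hw'),
      coord_diagSemigroup b hl hz', coord_diagSemigroup b hl hw', ← mul_assoc, ← Complex.exp_add]
    ring_nf
  analytic := (differentiableOn_diagSemigroup b hl).mono fun _ => re_pos_of_mem_sector
  strongly_continuous := by
    refine tendsto_apply_of_tendsto_basis b (M := 2 * SchauderBasis.nnnormProjBound b) ?_ ?_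
    · filter_upwards [self_mem_nhdsWithin] with z hz
      rw [diagSemigroup, if_neg hz.1]
      exact norm_multiplier_le b (hl.isBVNull_exp_of_mem_sector hz)
    · intro k
      have hexp : Continuous fun z : ℂ => Complex.exp (-(lam k * z)) • b k := by fun_prop
      have hlim := (hexp.tendsto 0).mono_left (nhdsWithin_le_nhds (s := sector (Real.pi / 4)))
      simp only [mul_zero, neg_zero, Complex.exp_zero, one_smul] at hlim
      refine hlim.congr' ?_
      filter_upwards [self_mem_nhdsWithin] with z hz
      rw [diagSemigroup, if_neg hz.1, multiplier_basis b (hl.isBVNull_exp_of_mem_sector hz)]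
  bounded := ⟨2 * SchauderBasis.nnnormProjBound b, fun z hz => by
    rw [diagSemigroup, if_neg hz.1]
    exact norm_multiplier_le b (hl.isBVNull_exp_of_mem_sector hz)⟩

theorem tendsto_multiplier_expMean (x : X) :
    Tendsto (fun t => multiplier b (fun n => (expMean (lam n * t) : ℂ)) x) (𝓝[>] 0) (𝓝 x) := by
  refine tendsto_apply_of_tendsto_basis b (M := 1 * SchauderBasis.nnnormProjBound b) ?_ ?_ x
  · filter_upwards [self_mem_nhdsWithin] with t ht
    exact norm_multiplier_le b (hl.isBVNull_expMean ht)
  · intro k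
    have hlim := ((tendsto_expMean_mul (hl.pos k)).ofReal).smul_const (b k)
    rw [Complex.ofReal_one, one_smul] at hlim
    refine hlim.congr' ?_
    filter_upwards [self_mem_nhdsWithin] with t ht
    rw [multiplier_basis b (hl.isBVNull_expMean ht)]

theorem coord_diagSemigroup_sub_div {t : ℝ} (ht : 0 < t) (k : ℕ) (x : X) :
    b.coord k ((t : ℂ)⁻¹ • (diagSemigroup b lam t x - x)) =
      expMean (lam k * t) * -(lam k * b.coord k x) := by
  have ht0 : (t : ℂ) ≠ 0 := by exact_mod_cast ht.ne'
  have hl0 : (lam k : ℂ) ≠ 0 := by exact_mod_cast (hl.pos k).ne'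
  rw [map_smul, map_sub, coord_diagSemigroup b hl (by simpa using ht), expMean, smul_eq_mul]
  push_cast
  field_simp
  ring

theorem isGenerator_neg_diagOperator : IsGenerator (-diagOperator b lam) (diagSemigroup b lam) := by
  intro x y
  rw [mem_graph_neg_diagOperator]
  constructor
  · intro hxy
    refine (tendsto_multiplier_expMean b hl y).congr' ?_
    filter_upwards [self_mem_nhdsWithin] with t ht
    refine eq_of_coord_eq b fun k => ?_
    rw [coord_multiplier b (hl.isBVNull_expMean ht), coord_diagSemigroup_sub_div b hl ht, hxy k]
  · intro hlim k
    refine tendsto_nhds_unique (((b.coord k).continuous.tendsto y).comp hlim) ?_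
    have hmean := ((tendsto_expMean_mul (hl.pos k)).ofReal).mul_const
      (-(lam k * b.coord k x))
    rw [Complex.ofReal_one, one_mul] at hmean
    refine hmean.congr' ?_
    filter_upwards [self_mem_nhdsWithin] with t ht
      using (coord_diagSemigroup_sub_div b hl ht k x).symm

theorem generatesBoundedAnalyticSemigroup_neg_diagOperator :
    GeneratesBoundedAnalyticSemigroup (-diagOperator b lam) :=
  ⟨_, _, isBoundedAnalyticSemigroup_diagSemigroup b hl, isGenerator_neg_diagOperator b hl⟩

end DiagonalSemigroup

section Relaxation

variable {E : Type*} [NormedAddCommGroup E] [NormedSpace ℝ E]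

/-- The convolution of `h` on `[0, t]` with the exponential kernel `lam * exp (-lam s)`: it is
`lam • u`, where `u' + lam • u = h` and `u 0 = 0`. -/
noncomputable def relax (lam : ℝ) (h : ℝ → E) (t : ℝ) : E :=
  lam • ∫ s in (0 : ℝ)..t, Real.exp (lam * s - lam * t) • h s

theorem relax_const_smul {𝕜 : Type*} [RCLike 𝕜] [NormedSpace 𝕜 E] [SMulCommClass ℝ 𝕜 E]
    (lam : ℝ) (c : 𝕜) (h : ℝ → E) (t : ℝ) :
    relax lam (fun s => c • h s) t = c • relax lam h t := by
  simp only [relax, smul_comm _ c, intervalIntegral.integral_smul]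

theorem relax_sub (lam : ℝ) {g h : ℝ → E} (hg : Continuous g) (hh : Continuous h) (t : ℝ) :
    relax lam (fun s => g s - h s) t = relax lam g t - relax lam h t := by
  simp only [relax, smul_sub]
  rw [intervalIntegral.integral_sub (Continuous.intervalIntegrable (by fun_prop) _ _)
    (Continuous.intervalIntegrable (by fun_prop) _ _), smul_sub]

theorem relax_sum {ι : Type*} (lam : ℝ) {h : ι → ℝ → E} (hh : ∀ n, Continuous (h n))
    (F : Finset ι) (t : ℝ) :
    relax lam (fun s => ∑ n ∈ F, h n s) t = ∑ n ∈ F, relax lam (h n) t := by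
  simp only [relax, Finset.smul_sum]
  rw [intervalIntegral.integral_finsetSum fun n _ =>
    Continuous.intervalIntegrable (by have := hh n; fun_prop) _ _, Finset.smul_sum]

theorem hasSum_relax {lam : ℝ} {h : ℕ → ℝ → E} (hh : ∀ n, Continuous (h n)) {u : ℕ → ℝ}
    (hu : Summable u) (hb : ∀ n s, ‖h n s‖ ≤ u n) {g : ℝ → E}
    (hg : ∀ s, HasSum (fun n => h n s) (g s)) (t : ℝ) :
    HasSum (fun n => relax lam (h n) t) (relax lam g t) := by
  refine HasSum.const_smul _ (intervalIntegral.hasSum_integral_of_dominated_convergence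
    (fun n s => Real.exp (lam * s - lam * t) * u n) (fun n => ?_)
    (fun n => Eventually.of_forall fun s _ => ?_) (Eventually.of_forall fun s _ => hu.mul_left _)
    ?_ (Eventually.of_forall fun s _ => (hg s).const_smul _))
  · exact Continuous.aestronglyMeasurable (by have := hh n; fun_prop)
  · rw [norm_smul, Real.norm_of_nonneg (Real.exp_pos _).le]
    gcongr
    exact hb n s
  · simp_rw [tsum_mul_left]
    exact Continuous.intervalIntegrable (by fun_prop) _ _

theorem relax_congr {lam t : ℝ} {g h : ℝ → E} (ht : 0 ≤ t) (hgh : ∀ s ∈ Icc 0 t, g s = h s) :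
    relax lam g t = relax lam h t := by
  rw [relax, relax]
  congr 1
  refine intervalIntegral.integral_congr fun s hs => ?_
  rw [uIcc_of_le ht] at hs
  simp only [hgh s hs]

theorem mul_integral_exp_sub (lam t : ℝ) :
    lam * ∫ s in (0 : ℝ)..t, Real.exp (lam * s - lam * t) = 1 - Real.exp (-(lam * t)) := by
  rcases eq_or_ne lam 0 with rfl | hlam
  · simp
  · simp [intervalIntegral.integral_comp_mul_sub (fun s => Real.exp s) hlam, hlam]

theorem norm_relax_le {lam : ℝ} (hlam : 0 ≤ lam) {h : ℝ → E} {M : ℝ} (hM : ∀ s, ‖h s‖ ≤ M)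
    {t : ℝ} (ht : 0 ≤ t) : ‖relax lam h t‖ ≤ M := by
  have hbound : ‖∫ s in (0 : ℝ)..t, Real.exp (lam * s - lam * t) • h s‖ ≤
      ∫ s in (0 : ℝ)..t, Real.exp (lam * s - lam * t) * M := by
    refine intervalIntegral.norm_integral_le_of_norm_le ht (Eventually.of_forall fun s _ => ?_)
      (Continuous.intervalIntegrable (by fun_prop) _ _)
    rw [norm_smul, Real.norm_of_nonneg (Real.exp_pos _).le]
    gcongr
    exact hM s
  calc ‖relax lam h t‖ ≤ lam * ∫ s in (0 : ℝ)..t, Real.exp (lam * s - lam * t) * M := by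
        rw [relax, norm_smul, Real.norm_of_nonneg hlam]
        gcongr
    _ = (1 - Real.exp (-(lam * t))) * M := by
        rw [intervalIntegral.integral_mul_const, ← mul_assoc, mul_integral_exp_sub]
    _ ≤ M := mul_le_of_le_one_left ((norm_nonneg _).trans (hM 0))
        (sub_le_self _ (Real.exp_pos _).le)

variable [CompleteSpace E]

theorem relax_deriv (lam : ℝ) {H : ℝ → E} (hH : ContDiff ℝ 1 H) (t : ℝ) :
    relax lam (deriv H) t = lam • (H t - Real.exp (-(lam * t)) • H 0 - relax lam H t) := by
  have hexp : ∀ s, HasDerivAt (fun s => Real.exp (lam * s - lam * t))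
      (lam * Real.exp (lam * s - lam * t)) s := fun s => by
    simpa only [mul_comm] using ((hasDerivAt_const_mul lam (x := s)).sub_const (lam * t)).exp
  have hparts := intervalIntegral.integral_smul_deriv_eq_deriv_smul (a := 0) (b := t)
    (fun s _ => hexp s) (fun s _ => ((hH.differentiable one_ne_zero) s).hasDerivAt)
    (Continuous.intervalIntegrable (by fun_prop) _ _)
    ((hH.continuous_deriv le_rfl).intervalIntegrable _ _)
  simp only [relax, hparts, mul_smul, intervalIntegral.integral_smul]
  simp

theorem norm_relax_sub_le {lam : ℝ} (hlam : 0 < lam) {H : ℝ → E} (hH : ContDiff ℝ 1 H)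
    (h0 : H 0 = 0) {L : ℝ} (hL : ∀ s, ‖deriv H s‖ ≤ L) {t : ℝ} (ht : 0 ≤ t) :
    ‖relax lam H t - H t‖ ≤ L / lam := by
  have hderiv := norm_relax_le hlam.le hL ht
  rwa [relax_deriv lam hH, h0, smul_zero, sub_zero, norm_smul, Real.norm_of_nonneg hlam.le,
    norm_sub_rev, ← le_div_iff₀' hlam] at hderiv

theorem norm_relax_deriv_le {lam : ℝ} (hlam : 0 ≤ lam) {H : ℝ → E} (hH : ContDiff ℝ 1 H)
    {M : ℝ} (hM : ∀ s, ‖H s‖ ≤ M) {t : ℝ} (ht : 0 ≤ t) :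
    ‖relax lam (deriv H) t‖ ≤ 3 * lam * M := by
  have hexp : ‖Real.exp (-(lam * t)) • H 0‖ ≤ M := by
    rw [norm_smul, Real.norm_of_nonneg (Real.exp_pos _).le]
    exact (mul_le_of_le_one_left (norm_nonneg _)
      (Real.exp_le_one_iff.mpr (neg_nonpos.mpr (by positivity)))).trans (hM 0)
  rw [relax_deriv lam hH, norm_smul, Real.norm_of_nonneg hlam, mul_comm 3, mul_assoc]
  gcongr
  linarith [norm_sub_le (H t - Real.exp (-(lam * t)) • H 0) (relax lam H t),
    norm_sub_le (H t) (Real.exp (-(lam * t)) • H 0), hM t, norm_relax_le hlam hM ht]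

theorem norm_relax_sin_smul_le {lam mu : ℝ} (hlam : 0 ≤ lam) (hmu : 0 < mu) {g : ℝ → E}
    (hg : ContDiff ℝ 1 g) {G L : ℝ} (hG : ∀ s, ‖g s‖ ≤ G) (hL : ∀ s, ‖deriv g s‖ ≤ L)
    {t : ℝ} (ht : 0 ≤ t) :
    ‖relax lam (fun s => Real.sin (mu * s) • g s) t‖ ≤ (3 * lam * G + L) / mu := by
  set c : ℝ → ℝ := fun s => -Real.cos (mu * s) / mu
  have hc : ContDiff ℝ 1 c := by fun_prop
  have hcderiv : ∀ s, HasDerivAt c (Real.sin (mu * s)) s := fun s => by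
    convert! ((hasDerivAt_const_mul mu (x := s)).cos.neg).div_const mu using 1
    field_simp
  have hcle : ∀ {f : ℝ → E} {M : ℝ}, (∀ s, ‖f s‖ ≤ M) → ∀ s, ‖c s • f s‖ ≤ M / mu :=
    fun hf s => by
      rw [norm_smul, norm_div, norm_neg, Real.norm_of_nonneg hmu.le, div_mul_eq_mul_div]
      gcongr
      exact (mul_le_of_le_one_left (norm_nonneg _) (Real.abs_cos_le_one _)).trans (hf s)
  have hcg : ContDiff ℝ 1 fun s => c s • g s := hc.smul hg
  have hcg' : Continuous fun s => c s • deriv g s := hc.continuous.smul (hg.continuous_deriv le_rfl)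
  have hderiv : ∀ s, HasDerivAt (fun s => c s • g s)
      (c s • deriv g s + Real.sin (mu * s) • g s) s := fun s =>
    (hcderiv s).smul ((hg.differentiable one_ne_zero) s).hasDerivAt
  have hsin : (fun s => Real.sin (mu * s) • g s) =
      fun s => deriv (fun s => c s • g s) s - c s • deriv g s := funext fun s => by
    rw [(hderiv s).deriv, add_sub_cancel_left]
  rw [hsin, relax_sub lam (hcg.continuous_deriv le_rfl) hcg']
  calc _ ≤ 3 * lam * (G / mu) + L / mu := (norm_sub_le _ _).trans
        (add_le_add (norm_relax_deriv_le hlam hcg (hcle hG) ht)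
          (norm_relax_le hlam (hcle hL) ht))
    _ = (3 * lam * G + L) / mu := by ring

theorem smul_eq_relax_of_eq_integral {lam T : ℝ} {χ F : ℝ → E} (hχ : Continuous χ)
    (hF : Continuous F) (h : ∀ t ∈ Ico 0 T, χ t = ∫ s in (0 : ℝ)..t, (F s - lam • χ s))
    {t : ℝ} (ht : t ∈ Ico 0 T) : lam • χ t = relax lam F t := by
  set H : ℝ → E := fun t => ∫ s in (0 : ℝ)..t, (F s - lam • χ s)
  have hder : ∀ t, HasDerivAt H (F t - lam • χ t) t := fun t =>
    intervalIntegral.integral_hasDerivAt_right (Continuous.intervalIntegrable (by fun_prop) _ _)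
      (Continuous.stronglyMeasurableAtFilter (by fun_prop) _ _) (by fun_prop)
  have hderiv : deriv H = fun t => F t - lam • χ t := funext fun t => (hder t).deriv
  have hH : ContDiff ℝ 1 H := contDiff_one_iff_deriv.mpr
    ⟨fun t => (hder t).differentiableAt, by rw [hderiv]; fun_prop⟩
  have hχH : relax lam χ t = relax lam H t :=
    relax_congr ht.1 fun s hs => h s ⟨hs.1, hs.2.trans_lt ht.2⟩
  have hparts := relax_deriv lam hH t
  rw [hderiv, relax_sub lam hF (show Continuous fun t => lam • χ t by fun_prop),
    relax_const_smul, hχH, show H 0 = 0 from intervalIntegral.integral_same, smul_zero, sub_zero,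
    smul_sub, sub_left_inj] at hparts
  rw [h t ht, hparts]

theorem ae_smul_eq_relax {lam T : ℝ} {φ F : ℝ → E} (hF : Continuous F)
    (hφ : IntegrableOn φ (Ico 0 T))
    (h : ∀ᵐ t ∂(volume.restrict (Ico (0 : ℝ) T)), φ t = ∫ s in (0 : ℝ)..t, (F s - lam • φ s)) :
    ∀ᵐ t ∂(volume.restrict (Ico (0 : ℝ) T)), lam • φ t = relax lam F t := by
  set g : ℝ → E := (Ico 0 T).indicator fun s => F s - lam • φ s
  have hg : Integrable g := ((hF.integrableOn_Icc.mono_set Ico_subset_Icc_self).sub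
    (hφ.smul lam)).integrable_indicator measurableSet_Ico
  set χ : ℝ → E := fun t => ∫ s in (0 : ℝ)..t, g s
  have hχ : Continuous χ := intervalIntegral.continuous_primitive
    (fun _ _ => hg.intervalIntegrable) 0
  have hmem : ∀ {s t}, t ∈ Ico 0 T → s ∈ uIoc 0 t → s ∈ Ico 0 T := fun ht hs => by
    rw [uIoc_of_le ht.1] at hs
    exact ⟨hs.1.le, hs.2.trans_lt ht.2⟩
  have hχint : ∀ t ∈ Ico 0 T, χ t = ∫ s in (0 : ℝ)..t, (F s - lam • φ s) := fun t ht =>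
    intervalIntegral.integral_congr_ae (Eventually.of_forall fun s hs =>
      indicator_of_mem (hmem ht hs) _)
  have hφχ : ∀ᵐ t ∂(volume.restrict (Ico (0 : ℝ) T)), φ t = χ t := by
    filter_upwards [h, self_mem_ae_restrict measurableSet_Ico] with t hφt ht
    rw [hφt, hχint t ht]
  have hχeq : ∀ t ∈ Ico 0 T, χ t = ∫ s in (0 : ℝ)..t, (F s - lam • χ s) := fun t ht => by
    rw [hχint t ht]
    refine intervalIntegral.integral_congr_ae ?_
    filter_upwards [(ae_restrict_iff' measurableSet_Ico).mp hφχ] with s hs hst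
    rw [hs (hmem ht hst)]
  filter_upwards [hφχ, self_mem_ae_restrict measurableSet_Ico] with t hφt ht
  rw [hφt, smul_eq_relax_of_eq_integral hχ hF hχeq ht]

end Relaxation

section RieszProducts

/-- The Riesz product `∏ j < n, (1 + i b_j sin (ω_j t))`. -/
noncomputable def riesz (ω b : ℕ → ℝ) (n : ℕ) (t : ℝ) : ℂ :=
  ∏ j ∈ Finset.range n, (1 + (b j * Real.sin (ω j * t) : ℝ) * Complex.I)

/-- The increment that the factor of frequency `ω_n` adds to the Riesz product. -/
noncomputable def rieszIncr (ω b : ℕ → ℝ) (n : ℕ) (t : ℝ) : ℂ :=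
  riesz ω b (n + 1) t - riesz ω b n t

variable (ω b : ℕ → ℝ)

theorem riesz_sub_one_eq_sum (n : ℕ) (t : ℝ) :
    riesz ω b n t - 1 = ∑ j ∈ Finset.range n, rieszIncr ω b j t := by
  simp only [rieszIncr, Finset.sum_range_sub (fun j => riesz ω b j t)]
  simp [riesz]

theorem rieszIncr_eq_smul (n : ℕ) (t : ℝ) :
    rieszIncr ω b n t = (Complex.I * b n) • (Real.sin (ω n * t) • riesz ω b n t) := by
  rw [rieszIncr, riesz, riesz, Finset.prod_range_succ, smul_eq_mul, Complex.real_smul]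
  push_cast
  ring

theorem contDiff_riesz (n : ℕ) : ContDiff ℝ 1 (riesz ω b n) :=
  contDiff_prod fun j _ => contDiff_const.add
    ((Complex.ofRealCLM.contDiff.comp (f := fun t => b j * Real.sin (ω j * t))
      (by fun_prop)).mul contDiff_const)

theorem contDiff_rieszIncr (n : ℕ) : ContDiff ℝ 1 (rieszIncr ω b n) :=
  (contDiff_riesz ω b (n + 1)).sub (contDiff_riesz ω b n)

@[fun_prop]
theorem continuous_riesz (n : ℕ) : Continuous (riesz ω b n) := (contDiff_riesz ω b n).continuous

@[fun_prop]
theorem continuous_rieszIncr (n : ℕ) : Continuous (rieszIncr ω b n) :=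
  (contDiff_rieszIncr ω b n).continuous

theorem norm_one_add_ofReal_mul_I_sq (x : ℝ) : ‖1 + (x : ℂ) * Complex.I‖ ^ 2 = 1 + x ^ 2 := by
  rw [← Complex.normSq_eq_norm_sq, ← Complex.ofReal_one, Complex.normSq_add_mul_I, one_pow]

theorem norm_riesz_sq (n : ℕ) (t : ℝ) :
    ‖riesz ω b n t‖ ^ 2 = ∏ j ∈ Finset.range n, (1 + b j ^ 2 * Real.sin (ω j * t) ^ 2) := by
  simp_rw [riesz, norm_prod, ← Finset.prod_pow, norm_one_add_ofReal_mul_I_sq, mul_pow]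

theorem norm_riesz_sq_le (n : ℕ) (t : ℝ) :
    ‖riesz ω b n t‖ ^ 2 ≤ ∏ j ∈ Finset.range n, (1 + b j ^ 2) := by
  rw [norm_riesz_sq]
  gcongr
  exact mul_le_of_le_one_right (sq_nonneg _) (Real.sin_sq_le_one _)

theorem one_add_sum_le_prod_one_add {β : ℕ → ℝ} (hβ : ∀ j, 0 ≤ β j) (n : ℕ) :
    1 + ∑ j ∈ Finset.range n, β j ≤ ∏ j ∈ Finset.range n, (1 + β j) := by
  induction n with
  | zero => simp
  | succ n ih =>
    rw [Finset.sum_range_succ, Finset.prod_range_succ]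
    nlinarith [hβ n, Finset.sum_nonneg fun j (_ : j ∈ Finset.range n) => hβ j]

theorem one_add_sum_le_norm_riesz_sq (n : ℕ) (t : ℝ) :
    1 + ∑ j ∈ Finset.range n, b j ^ 2 * Real.sin (ω j * t) ^ 2 ≤ ‖riesz ω b n t‖ ^ 2 := by
  rw [norm_riesz_sq]
  exact one_add_sum_le_prod_one_add (fun j => by positivity) n

theorem one_le_norm_riesz (n : ℕ) (t : ℝ) : 1 ≤ ‖riesz ω b n t‖ :=
  (one_le_sq_iff₀ (norm_nonneg _)).mp <|
    (le_add_of_nonneg_right (Finset.sum_nonneg fun _ _ => by positivity)).trans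
      (one_add_sum_le_norm_riesz_sq ω b n t)

variable {ω b}

theorem norm_rieszIncr {n : ℕ} (hb : 0 ≤ b n) (t : ℝ) :
    ‖rieszIncr ω b n t‖ = b n * (|Real.sin (ω n * t)| * ‖riesz ω b n t‖) := by
  rw [rieszIncr_eq_smul, norm_smul, norm_smul, norm_mul, Complex.norm_I, one_mul,
    Complex.norm_real, Real.norm_of_nonneg hb, Real.norm_eq_abs]

variable (hb : ∀ n, b n ∈ Icc (0 : ℝ) 1)
include hb

theorem norm_riesz_le_two_pow (n : ℕ) (t : ℝ) : ‖riesz ω b n t‖ ≤ 2 ^ n := by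
  have hfactor : ∀ j, ‖(1 + (b j * Real.sin (ω j * t) : ℝ) * Complex.I : ℂ)‖ ≤ 2 := fun j => by
    rw [← sq_le_sq₀ (norm_nonneg _) zero_le_two, norm_one_add_ofReal_mul_I_sq, mul_pow]
    nlinarith [(hb j).1, (hb j).2, sq_nonneg (b j), Real.sin_sq_le_one (ω j * t)]
  rw [riesz, norm_prod]
  exact (Finset.prod_le_prod (fun _ _ => norm_nonneg _) fun j _ => hfactor j).trans_eq (by simp)

theorem norm_deriv_riesz_succ_le (n : ℕ) (t : ℝ) :
    ‖deriv (riesz ω b (n + 1)) t‖ ≤ |ω n| * 2 ^ n + 2 * ‖deriv (riesz ω b n) t‖ := by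
  have hsin : HasDerivAt (fun t => Real.sin (ω n * t)) (Real.cos (ω n * t) * ω n) t :=
    (hasDerivAt_const_mul (ω n)).sin
  have hriesz : HasDerivAt (riesz ω b n) (deriv (riesz ω b n) t) t :=
    ((contDiff_riesz ω b n).differentiable one_ne_zero t).hasDerivAt
  have hsucc : riesz ω b (n + 1) = fun t =>
      riesz ω b n t + (Complex.I * b n) • (Real.sin (ω n * t) • riesz ω b n t) :=
    funext fun t => by rw [← rieszIncr_eq_smul, rieszIncr, add_sub_cancel]
  have hderiv : deriv (riesz ω b (n + 1)) t = deriv (riesz ω b n) t + (Complex.I * b n) •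
      (Real.sin (ω n * t) • deriv (riesz ω b n) t +
        (Real.cos (ω n * t) * ω n) • riesz ω b n t) := by
    rw [hsucc]
    exact (hriesz.add ((hsin.smul hriesz).const_smul (Complex.I * b n : ℂ))).deriv
  have hIb : ‖Complex.I * (b n : ℂ)‖ ≤ 1 := by
    simpa [abs_of_nonneg (hb n).1] using (hb n).2
  have hcos : ‖(Real.cos (ω n * t) * ω n) • riesz ω b n t‖ ≤ |ω n| * 2 ^ n := by
    rw [norm_smul, Real.norm_eq_abs, abs_mul]
    gcongr
    · exact mul_le_of_le_one_left (abs_nonneg _) (Real.abs_cos_le_one _)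
    · exact norm_riesz_le_two_pow hb n t
  have hsin' : ‖Real.sin (ω n * t) • deriv (riesz ω b n) t‖ ≤ ‖deriv (riesz ω b n) t‖ := by
    rw [norm_smul]
    exact mul_le_of_le_one_left (norm_nonneg _) (Real.abs_sin_le_one _)
  rw [hderiv]
  calc _ ≤ ‖deriv (riesz ω b n) t‖ + (‖deriv (riesz ω b n) t‖ + |ω n| * 2 ^ n) :=
        norm_add_le_of_le le_rfl <| by
          rw [norm_smul]
          exact (mul_le_of_le_one_left (norm_nonneg _) hIb).trans (norm_add_le_of_le hsin' hcos)
    _ = _ := by ring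

theorem norm_deriv_riesz_le {A : ℝ} (hA0 : 0 ≤ A) {n : ℕ} (hA : ∀ j < n, |ω j| ≤ A) (t : ℝ) :
    ‖deriv (riesz ω b n) t‖ ≤ 4 ^ n * A := by
  induction n with
  | zero =>
    have hone : riesz ω b 0 = fun _ => (1 : ℂ) := rfl
    simpa [hone] using hA0
  | succ n ih =>
    have hpow : (2 : ℝ) ^ n ≤ 4 ^ n := pow_le_pow_left₀ zero_le_two (by norm_num) n
    calc ‖deriv (riesz ω b (n + 1)) t‖
        ≤ |ω n| * 2 ^ n + 2 * ‖deriv (riesz ω b n) t‖ := norm_deriv_riesz_succ_le hb n t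
      _ ≤ A * 4 ^ n + 2 * (4 ^ n * A) := by
          gcongr
          · exact hA n n.lt_succ_self
          · exact ih fun j hj => hA j (hj.trans n.lt_succ_self)
      _ ≤ 4 ^ (n + 1) * A := by
          rw [pow_succ]
          nlinarith [mul_nonneg (pow_nonneg (zero_le_four (α := ℝ)) n) hA0]

end RieszProducts

section FrequencyCutoff

/-- The frequencies of the Riesz products used in the counterexamples. -/
def freq (k : ℕ) : ℝ := 64 ^ (k ^ 2)

/-- The exponents of the diagonal operators of the counterexamples. They interlace with the
frequencies: `freq k ≪ rate k ≪ freq (k + 1)`. -/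
def rate (k : ℕ) : ℝ := 64 ^ (k ^ 2 + k)

theorem freq_pos (k : ℕ) : 0 < freq k := by unfold freq; positivity

theorem rate_pos (k : ℕ) : 0 < rate k := by unfold rate; positivity

theorem rate_eq (k : ℕ) : rate k = freq k * 64 ^ k := pow_add _ _ _

theorem freq_succ (k : ℕ) : freq (k + 1) = rate k * 64 ^ (k + 1) := by
  rw [freq, rate, ← pow_add]
  ring_nf

theorem freq_monotone : Monotone freq := fun m n hmn => by
  unfold freq
  gcongr
  norm_num

theorem rate_monotone : Monotone rate := fun m n hmn => by
  unfold rate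
  gcongr
  norm_num

theorem freq_le_rate (k : ℕ) : freq k ≤ rate k := by
  rw [rate_eq]
  exact le_mul_of_one_le_right (freq_pos k).le (one_le_pow₀ (by norm_num))

theorem abs_freq_le {j k : ℕ} (hjk : j ≤ k) : |freq j| ≤ freq k :=
  (abs_of_pos (freq_pos j)).trans_le (freq_monotone hjk)

theorem tendsto_freq : Tendsto freq atTop atTop :=
  (tendsto_pow_atTop_atTop_of_one_lt (by norm_num)).comp (tendsto_pow_atTop two_ne_zero)

theorem isExponentSequence_rate : IsExponentSequence rate where
  mono := rate_monotone
  pos := rate_pos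
  tendsto_atTop := tendsto_atTop_mono freq_le_rate tendsto_freq

variable {b : ℕ → ℝ} (hb : ∀ n, b n ∈ Icc (0 : ℝ) 1) {j k : ℕ} {t : ℝ} (ht : 0 ≤ t)
include hb ht

theorem norm_relax_rieszIncr_sub_le (hjk : j ≤ k) :
    ‖relax (rate k) (rieszIncr freq b j) t - rieszIncr freq b j t‖ ≤ 5 * (1 / 16) ^ k := by
  have hderiv : ∀ s, ‖deriv (rieszIncr freq b j) s‖ ≤ 5 * 4 ^ j * freq j := fun s => by
    have hdiff : ∀ n, DifferentiableAt ℝ (riesz freq b n) s := fun n =>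
      (contDiff_riesz freq b n).differentiable one_ne_zero s
    have hincr : deriv (rieszIncr freq b j) s =
        deriv (riesz freq b (j + 1)) s - deriv (riesz freq b j) s :=
      ((hdiff (j + 1)).hasDerivAt.sub (hdiff j).hasDerivAt).deriv
    rw [hincr]
    refine (norm_sub_le_of_le (norm_deriv_riesz_le (n := j + 1) hb (freq_pos j).le
        (fun i hi => abs_freq_le (Nat.le_of_lt_succ hi)) s)
      (norm_deriv_riesz_le hb (freq_pos j).le (fun i hi => abs_freq_le hi.le) s)).trans_eq ?_
    ring
  calc _ ≤ 5 * 4 ^ j * freq j / rate k :=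
        norm_relax_sub_le (rate_pos k) (contDiff_rieszIncr freq b j)
          (by simp [rieszIncr, riesz]) hderiv ht
    _ ≤ 5 * 4 ^ k * freq k / rate k := by
        have := (rate_pos k).le
        have := (freq_pos j).le
        gcongr
        · norm_num
        · exact freq_monotone hjk
    _ = 5 * (1 / 16) ^ k := by
        have := (freq_pos k).ne'
        rw [rate_eq, show (64 : ℝ) = 4 * 16 by norm_num, mul_pow, one_div, inv_pow]
        field_simp

theorem norm_relax_rieszIncr_le (hkj : k < j) :
    ‖relax (rate k) (rieszIncr freq b j) t‖ ≤ 4 * (1 / 16) ^ j := by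
  obtain ⟨i, rfl⟩ := Nat.exists_eq_add_one_of_ne_zero (Nat.ne_zero_of_lt hkj)
  have hki : rate k ≤ rate i := rate_monotone (Nat.le_of_lt_succ hkj)
  have hderiv : ∀ s, ‖deriv (riesz freq b (i + 1)) s‖ ≤ 4 ^ (i + 1) * rate i :=
    norm_deriv_riesz_le hb (rate_pos i).le fun l hl =>
      (abs_freq_le (Nat.le_of_lt_succ hl)).trans (freq_le_rate i)
  have hpow : (2 : ℝ) ^ (i + 1) ≤ 4 ^ (i + 1) := pow_le_pow_left₀ zero_le_two (by norm_num) _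
  have hIb : ‖Complex.I * (b (i + 1) : ℂ)‖ ≤ 1 := by
    simpa [abs_of_nonneg (hb (i + 1)).1] using (hb (i + 1)).2
  rw [funext (rieszIncr_eq_smul freq b (i + 1)), relax_const_smul, norm_smul]
  calc _ ≤ ‖relax (rate k) (fun s => Real.sin (freq (i + 1) * s) • riesz freq b (i + 1) s) t‖ :=
        mul_le_of_le_one_left (norm_nonneg _) hIb
    _ ≤ (3 * rate k * 2 ^ (i + 1) + 4 ^ (i + 1) * rate i) / freq (i + 1) :=
        norm_relax_sin_smul_le (rate_pos k).le (freq_pos _) (contDiff_riesz freq b _)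
          (norm_riesz_le_two_pow hb _) hderiv ht
    _ ≤ (3 * rate i * 4 ^ (i + 1) + 4 ^ (i + 1) * rate i) / freq (i + 1) := by
        have := (freq_pos (i + 1)).le
        have := (rate_pos i).le
        gcongr
    _ = 4 * (1 / 16) ^ (i + 1) := by
        have := (rate_pos i).ne'
        rw [freq_succ, show (64 : ℝ) = 4 * 16 by norm_num, mul_pow, one_div, inv_pow]
        field_simp
        norm_num

theorem norm_relax_riesz_sub_le {m : ℕ} (hkm : k < m) :
    ‖relax (rate k) (fun s => riesz freq b m s - 1) t - (riesz freq b (k + 1) t - 1)‖ ≤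
      10 * (1 / 4) ^ k := by
  simp_rw [riesz_sub_one_eq_sum]
  rw [relax_sum _ (continuous_rieszIncr freq b),
    ← Finset.sum_range_add_sum_Ico _ (Nat.succ_le_of_lt hkm), add_sub_right_comm,
    ← Finset.sum_sub_distrib]
  have hlow : ‖∑ j ∈ Finset.range (k + 1),
      (relax (rate k) (rieszIncr freq b j) t - rieszIncr freq b j t)‖ ≤ 5 * (1 / 4) ^ k := by
    have hcard : ((k + 1 : ℕ) : ℝ) ≤ 4 ^ k := by
      exact_mod_cast Nat.succ_le_of_lt (Nat.lt_pow_self (by norm_num))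
    refine (norm_sum_le_of_le _ fun j hj =>
      norm_relax_rieszIncr_sub_le hb ht (Finset.mem_range_succ_iff.mp hj)).trans ?_
    rw [Finset.sum_const, Finset.card_range, nsmul_eq_mul]
    calc ((k + 1 : ℕ) : ℝ) * (5 * (1 / 16) ^ k) ≤ 4 ^ k * (5 * (1 / 16) ^ k) := by gcongr
      _ = 5 * (4 * (1 / 16)) ^ k := by rw [mul_pow]; ring
      _ = 5 * (1 / 4) ^ k := by norm_num
  have hhigh : ‖∑ j ∈ Finset.Ico (k + 1) m, relax (rate k) (rieszIncr freq b j) t‖ ≤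
      5 * (1 / 4) ^ k := by
    refine (norm_sum_le_of_le _ fun j hj =>
      norm_relax_rieszIncr_le hb ht (Finset.mem_Ico.mp hj).1).trans ?_
    rw [← Finset.mul_sum]
    calc _ ≤ 4 * ((1 / 16 : ℝ) ^ (k + 1) / (1 - 1 / 16)) := by
          gcongr
          exact geom_sum_Ico_le_of_lt_one (by norm_num) (by norm_num)
      _ = 4 / 15 * (1 / 16) ^ k := by ring
      _ ≤ 5 * (1 / 4) ^ k := by gcongr <;> norm_num
  linarith [norm_add_le_of_le hlow hhigh]

end FrequencyCutoff

section CantorLebesgue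

variable {S : Set ℝ} (hS : MeasurableSet S) (hfin : volume S ≠ ∞)
include hS hfin

theorem tendsto_setIntegral_cos_mul :
    Tendsto (fun w => ∫ t in S, Real.cos (w * t)) atTop (𝓝 0) := by
  have hre : ∀ w : ℝ, ∫ t in S, Real.cos (w * t) =
      (FourierTransform.fourier (S.indicator (1 : ℝ → ℂ)) (w / (2 * Real.pi))).re := fun w => by
    have hexp : ∀ t : ℝ, (-2 * Real.pi * t * (w / (2 * Real.pi)) : ℝ) = -(w * t) := fun t => by
      field_simp
    have hintegrable : IntegrableOn (fun t : ℝ => Complex.exp ((-(w * t) : ℝ) * Complex.I)) S :=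
      IntegrableOn.of_bound hfin.lt_top (by fun_prop) 1
        (Eventually.of_forall fun t => (Complex.norm_exp_ofReal_mul_I _).le)
    have hind : ∀ t : ℝ, Complex.exp ((-(w * t) : ℝ) * Complex.I) • S.indicator (1 : ℝ → ℂ) t =
        S.indicator (fun t : ℝ => Complex.exp ((-(w * t) : ℝ) * Complex.I)) t := fun t => by
      by_cases ht : t ∈ S <;> simp [ht]
    simp_rw [Real.fourier_real_eq_integral_exp_smul, hexp, hind]
    rw [integral_indicator hS]
    have hcos : ∀ t, Real.cos (w * t) = (Complex.exp ((-(w * t) : ℝ) * Complex.I)).re := fun t => by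
      rw [Complex.exp_ofReal_mul_I_re, Real.cos_neg]
    simp_rw [hcos]
    exact integral_re hintegrable
  simp_rw [hre]
  have hlim := (Real.zero_at_infty_fourier (S.indicator (1 : ℝ → ℂ))).comp
    (atTop_le_cocompact.trans' (tendsto_id.atTop_div_const Real.two_pi_pos))
  simpa using! (Complex.continuous_re.tendsto 0).comp hlim

theorem tendsto_setIntegral_sin_sq :
    Tendsto (fun w => ∫ t in S, Real.sin (w * t) ^ 2) atTop (𝓝 (volume.real S / 2)) := by
  have hcos : ∀ w : ℝ, ∫ t in S, Real.sin (w * t) ^ 2 =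
      volume.real S / 2 - (∫ t in S, Real.cos (2 * w * t)) / 2 := fun w => by
    have hintegrable : IntegrableOn (fun t => Real.cos (2 * w * t)) S :=
      IntegrableOn.of_bound hfin.lt_top (by fun_prop) 1
        (Eventually.of_forall fun t => Real.abs_cos_le_one _)
    have hconst : IntegrableOn (fun _ : ℝ => (1 / 2 : ℝ)) S := integrableOn_const hfin
    simp_rw [Real.sin_sq_eq_half_sub, ← mul_assoc]
    rw [integral_sub hconst.integrable (hintegrable.integrable.div_const 2), setIntegral_const,
      integral_div, smul_eq_mul, mul_one_div]
  have hlim := (tendsto_setIntegral_cos_mul hS hfin).comp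
    (tendsto_id.const_mul_atTop (zero_lt_two' ℝ))
  simp_rw [hcos]
  simpa using! (hlim.div_const 2).const_sub (volume.real S / 2)

omit hS hfin

variable {ω β : ℕ → ℝ} (hω : Tendsto ω atTop atTop) (hβ : ∀ k, 0 ≤ β k)
include hω hβ

theorem summable_of_sum_mul_sin_sq_le (hS : MeasurableSet S) (hfin : volume S ≠ ∞)
    (hS0 : volume S ≠ 0) {M : ℝ}
    (h : ∀ t ∈ S, ∀ N, ∑ k ∈ Finset.range N, β k * Real.sin (ω k * t) ^ 2 ≤ M) : Summable β := by
  have hpos : 0 < volume.real S := ENNReal.toReal_pos hS0 hfin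
  have hsin : ∀ k, IntegrableOn (fun t => Real.sin (ω k * t) ^ 2) S := fun k =>
    IntegrableOn.of_bound hfin.lt_top (by fun_prop) 1 (Eventually.of_forall fun t => by
      simpa using Real.abs_sin_le_one _)
  have hintegrable : ∀ k, IntegrableOn (fun t => β k * Real.sin (ω k * t) ^ 2) S := fun k =>
    (hsin k).integrable.const_mul (β k)
  have hsum : Summable fun k => β k * ∫ t in S, Real.sin (ω k * t) ^ 2 := by
    refine summable_of_sum_range_le (c := volume.real S * M) (fun k =>
      mul_nonneg (hβ k) (integral_nonneg fun t => sq_nonneg _)) fun N => ?_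
    simp_rw [← integral_const_mul]
    rw [← integral_finsetSum _ fun k _ => hintegrable k, ← smul_eq_mul, ← setIntegral_const]
    exact setIntegral_mono_on (integrable_finsetSum _ fun k _ => hintegrable k)
      (integrableOn_const hfin) hS fun t ht => h t ht N
  refine Summable.of_norm_bounded_eventually_nat (hsum.mul_left (4 / volume.real S)) ?_
  filter_upwards [((tendsto_setIntegral_sin_sq hS hfin).comp hω).eventually
    (lt_mem_nhds (show volume.real S / 4 < volume.real S / 2 by linarith))] with k hk
  rw [Real.norm_of_nonneg (hβ k), mul_left_comm]
  refine le_mul_of_one_le_right (hβ k) ?_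
  rw [div_mul_eq_mul_div, one_le_div hpos]
  linarith [show _ < ∫ t in S, Real.sin (ω k * t) ^ 2 from hk]

/-- The Cantor–Lebesgue theorem. -/
theorem ae_not_summable_mul_sin_sq (hβs : ¬ Summable β) :
    ∀ᵐ t : ℝ, ¬ Summable fun k => β k * Real.sin (ω k * t) ^ 2 := by
  set S : ℕ → Set ℝ := fun M => Icc (-M) M ∩
    ⋂ N, {t | ∑ k ∈ Finset.range N, β k * Real.sin (ω k * t) ^ 2 ≤ M}
  have hS : ∀ M, MeasurableSet (S M) := fun M => measurableSet_Icc.inter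
    (MeasurableSet.iInter fun N => measurableSet_le (by fun_prop) measurable_const)
  have hfin : ∀ M, volume (S M) ≠ ∞ := fun M =>
    measure_ne_top_of_subset inter_subset_left measure_Icc_lt_top.ne
  have hnull : ∀ M, volume (S M) = 0 := fun M => by
    by_contra hM
    exact hβs (summable_of_sum_mul_sin_sq_le hω hβ (hS M) (hfin M) hM
      fun t ht N => by simpa using mem_iInter.mp ht.2 N)
  refine measure_mono_null (fun t ht => mem_iUnion.mpr ?_) (measure_iUnion_null hnull)
  have hsum : Summable fun k => β k * Real.sin (ω k * t) ^ 2 := not_not.mp ht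
  obtain ⟨M, hM⟩ := exists_nat_ge (max |t| (∑' k, β k * Real.sin (ω k * t) ^ 2))
  refine ⟨M, abs_le.mp ((le_max_left _ _).trans hM), mem_iInter.mpr fun N => ?_⟩
  exact (hsum.sum_le_tsum _ fun k _ => mul_nonneg (hβ k) (sq_nonneg _)).trans
    ((le_max_right _ _).trans hM)

end CantorLebesgue

section FailureCriterion

variable {X : Type*} [NormedAddCommGroup X] [NormedSpace ℂ X] [CompleteSpace X]
  (b : SchauderBasis ℂ X) {lam : ℕ → ℝ}

theorem ae_coord_eq_relax {p : ℝ≥0∞} (hp : 1 ≤ p) {T : ℝ} {u v w g : LpTime X p T}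
    (hv : HasDerivZero u v) (hw : HasImage (diagOperator b lam) u w) (hvw : v + w = g)
    {f : ℝ → X} (hf : Continuous f) (hgf : g =ᵐ[volume.restrict (Ico 0 T)] f) (n : ℕ) :
    ∀ᵐ t ∂(volume.restrict (Ico 0 T)), b.coord n (w t) =
      relax (lam n) (fun s => b.coord n (f s)) t := by
  have hvi : IntegrableOn v (Ico 0 T) := (Lp.memLp v).integrable hp
  have hui : IntegrableOn (fun t => b.coord n (u t)) (Ico 0 T) :=
    (b.coord n).integrable_comp ((Lp.memLp u).integrable hp)
  have hcoord : ∀ᵐ t ∂(volume.restrict (Ico 0 T)),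
      b.coord n (w t) = lam n • b.coord n (u t) := by
    filter_upwards [hw] with t ht
    rw [(mem_graph_diagOperator b).mp ht n, Complex.real_smul]
  have hderiv : ∀ᵐ t ∂(volume.restrict (Ico 0 T)),
      b.coord n (v t) = b.coord n (f t) - lam n • b.coord n (u t) := by
    filter_upwards [Lp.coeFn_add v w, hgf, hcoord] with t hadd hgt hwt
    rw [← hwt, ← hgt, ← hvw, hadd, Pi.add_apply, map_add, add_sub_cancel_right]
  have hode : ∀ᵐ t ∂(volume.restrict (Ico 0 T)), b.coord n (u t) =
      ∫ s in (0 : ℝ)..t, (b.coord n (f s) - lam n • b.coord n (u s)) := by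
    rw [ae_restrict_iff' measurableSet_Ico] at hderiv
    filter_upwards [hv, self_mem_ae_restrict measurableSet_Ico] with t ht htT
    have hsub : Ioc 0 t ⊆ Ico 0 T := fun s hs => ⟨hs.1.le, hs.2.trans_lt htT.2⟩
    rw [ht, ← (b.coord n).intervalIntegral_comp_comm
      ((intervalIntegrable_iff_integrableOn_Ioc_of_le htT.1).mpr (hvi.mono_set hsub))]
    refine intervalIntegral.integral_congr_ae ?_
    filter_upwards [hderiv] with s hs hst
    exact hs (hsub (by rwa [uIoc_of_le htT.1] at hst))
  filter_upwards [hcoord, ae_smul_eq_relax ((b.coord n).continuous.comp hf) hui hode]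
    with t hwt hrelax
  rw [hwt, hrelax, Function.comp_def]

variable {f : ℝ → X} (hf : Continuous f) {M : ℝ} (hM : ∀ t, ‖f t‖ ≤ M)
  (hbad : ∀ᵐ t : ℝ, 0 ≤ t →
    ∀ y, ¬ ∀ n, b.coord n y = relax (lam n) (fun s => b.coord n (f s)) t)
include hf hM hbad

theorem not_hasMaximalRegularity_diagOperator : ¬ HasMaximalRegularity (diagOperator b lam) := by
  rintro ⟨p, T, hp, -, hT, hsolve, -⟩
  have hmem : MemLp f p (volume.restrict (Ico 0 T)) :=
    MemLp.of_bound hf.aestronglyMeasurable M (Eventually.of_forall hM)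
  obtain ⟨u, ⟨v, w, hv, hw, hvw⟩, -⟩ := hsolve hmem.toLp
  have hcoord : ∀ᵐ t ∂(volume.restrict (Ico 0 T)),
      ∀ n, b.coord n (w t) = relax (lam n) (fun s => b.coord n (f s)) t :=
    ae_all_iff.mpr (ae_coord_eq_relax b hp.le hv hw hvw hf hmem.coeFn_toLp)
  have hfalse : ∀ᵐ _ ∂(volume.restrict (Ico 0 T)), False := by
    filter_upwards [hcoord, ae_restrict_of_ae hbad, self_mem_ae_restrict measurableSet_Ico]
      with t ht hbad_t htT using hbad_t htT.1 (w t) ht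
  rw [eventually_false_iff_eq_bot, ae_eq_bot, Measure.restrict_eq_zero, Real.volume_Ico, sub_zero,
    ENNReal.ofReal_eq_zero] at hfalse
  exact hfalse.not_gt hT

theorem not_maximalRegularityProperty_of_schauderBasis (hl : IsExponentSequence lam) :
    ¬ MaximalRegularityProperty X := fun hX =>
  not_hasMaximalRegularity_diagOperator b hf hM hbad
    (hX _ (generatesBoundedAnalyticSemigroup_neg_diagOperator b hl))

end FailureCriterion

section PowerSequences

/-- The sequence `(k + 1) ^ (-α)`, from which the coefficients and weights of the counterexamples
are built. -/
noncomputable def invPow (α : ℝ) (k : ℕ) : ℝ := ((k : ℝ) + 1) ^ (-α)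

variable {α : ℝ}

theorem invPow_nonneg (α : ℝ) (k : ℕ) : 0 ≤ invPow α k := by unfold invPow; positivity

theorem invPow_zero (α : ℝ) : invPow α 0 = 1 := by simp [invPow]

theorem invPow_add (α β : ℝ) (k : ℕ) : invPow (α + β) k = invPow α k * invPow β k := by
  rw [invPow, neg_add, Real.rpow_add (by positivity), invPow, invPow]

theorem antitone_invPow (hα : 0 ≤ α) : Antitone (invPow α) := fun m n hmn =>
  Real.rpow_le_rpow_of_nonpos (by positivity) (by gcongr) (neg_nonpos.mpr hα)

theorem invPow_le_one (hα : 0 ≤ α) (k : ℕ) : invPow α k ≤ 1 :=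
  (antitone_invPow hα k.zero_le).trans_eq (invPow_zero α)

theorem tendsto_invPow (hα : 0 < α) : Tendsto (invPow α) atTop (𝓝 0) :=
  (tendsto_rpow_neg_atTop hα).comp
    (tendsto_atTop_add_const_right _ _ tendsto_natCast_atTop_atTop)

theorem summable_invPow_iff : Summable (invPow α) ↔ 1 < α := by
  rw [← neg_lt_neg_iff, ← Real.summable_nat_rpow,
    ← summable_nat_add_iff (f := fun n : ℕ => (n : ℝ) ^ (-α)) 1]
  simp only [Nat.cast_add, Nat.cast_one]
  exact Iff.rfl

end PowerSequences

section NullSequences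

variable {𝕜 : Type*} [NontriviallyNormedField 𝕜]

/-- A null sequence as an element of `c₀`. -/
def nullSeq (x : ℕ → 𝕜) (hx : Tendsto x atTop (𝓝 0)) : C₀(ℕ, 𝕜) where
  toFun := x
  continuous_toFun := continuous_of_discreteTopology
  zero_at_infty' := by rwa [cocompact_eq_cofinite, Nat.cofinite_eq_atTop]

theorem tendsto_c0 (x : C₀(ℕ, 𝕜)) : Tendsto x atTop (𝓝 0) := by
  have := x.zero_at_infty'
  rwa [cocompact_eq_cofinite, Nat.cofinite_eq_atTop] at this

theorem norm_apply_le_c0 (x : C₀(ℕ, 𝕜)) (n : ℕ) : ‖x n‖ ≤ ‖x‖ :=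
  x.toBCF.norm_coe_le_norm n

theorem norm_le_c0 {x : C₀(ℕ, 𝕜)} {C : ℝ} (hC : 0 ≤ C) (h : ∀ n, ‖x n‖ ≤ C) : ‖x‖ ≤ C :=
  (BoundedContinuousFunction.norm_le (f := x.toBCF) hC).mpr h

theorem continuous_nullSeq {Y : Type*} [TopologicalSpace Y] {x : Y → ℕ → 𝕜}
    (hx : ∀ t, Tendsto (x t) atTop (𝓝 0)) (hc : ∀ n, Continuous fun t => x t n) {d : ℕ → ℝ}
    (hd : Tendsto d atTop (𝓝 0)) (hxd : ∀ t n, ‖x t n‖ ≤ d n) :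
    Continuous fun t => nullSeq (x t) (hx t) := by
  refine continuous_iff_continuousAt.mpr fun t => Metric.tendsto_nhds.mpr fun ε hε => ?_
  obtain ⟨N, hN⟩ := (hd.eventually (gt_mem_nhds (by linarith : 0 < ε / 4))).exists_forall_of_atTop
  have hhead : ∀ᶠ s in 𝓝 t, ∀ n ∈ Finset.range N, ‖x s n - x t n‖ < ε / 2 := by
    refine (eventually_all_finset _).mpr fun n _ => ?_
    simpa only [dist_eq_norm] using Metric.tendsto_nhds.mp ((hc n).tendsto t) (ε / 2) (half_pos hε)
  filter_upwards [hhead] with s hs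
  rw [dist_eq_norm]
  refine (norm_le_c0 (half_pos hε).le fun n => ?_).trans_lt (half_lt_self hε)
  change ‖x s n - x t n‖ ≤ ε / 2
  by_cases hn : n < N
  · exact (hs n (Finset.mem_range.mpr hn)).le
  · linarith [hN n (not_lt.mp hn), norm_sub_le (x s n) (x t n), hxd s n, hxd t n]

/-- The evaluation functionals on `c₀`. -/
noncomputable def c0Eval (n : ℕ) : C₀(ℕ, 𝕜) →L[𝕜] 𝕜 :=
  LinearMap.mkContinuous
    { toFun := fun x => x n
      map_add' := fun _ _ => rfl
      map_smul' := fun _ _ => rfl } 1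
    fun x => (norm_apply_le_c0 x n).trans_eq (one_mul _).symm

/-- The vector `e₀ + ⋯ + e_k` of `c₀`. -/
def summingVector (k : ℕ) : C₀(ℕ, 𝕜) :=
  nullSeq (fun i => if i ≤ k then 1 else 0) <| tendsto_const_nhds.congr' <| by
    filter_upwards [eventually_gt_atTop k] with i hi
    rw [if_neg hi.not_ge]

theorem summingVector_apply (k i : ℕ) :
    (summingVector k : C₀(ℕ, 𝕜)) i = if i ≤ k then 1 else 0 := rfl

theorem sum_smul_summingVector_apply (x : C₀(ℕ, 𝕜)) (N i : ℕ) :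
    (∑ k ∈ Finset.range N, (x k - x (k + 1)) • (summingVector k : C₀(ℕ, 𝕜))) i =
      if i < N then x i - x N else 0 := by
  induction N with
  | zero => simp
  | succ N ih =>
    rw [Finset.sum_range_succ, ZeroAtInftyContinuousMap.add_apply, ih,
      ZeroAtInftyContinuousMap.smul_apply, summingVector_apply, smul_eq_mul]
    rcases lt_trichotomy i N with hi | rfl | hi
    · rw [if_pos hi, if_pos hi.le, if_pos (by omega)]
      ring
    · simp
    · rw [if_neg (by omega), if_neg (by omega), if_neg (by omega), mul_zero, add_zero]

theorem tendsto_sum_smul_summingVector (x : C₀(ℕ, 𝕜)) :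
    Tendsto (fun N => ∑ k ∈ Finset.range N, (x k - x (k + 1)) • (summingVector k : C₀(ℕ, 𝕜)))
      atTop (𝓝 x) := by
  rw [Metric.tendsto_nhds]
  intro ε hε
  obtain ⟨N₀, hN₀⟩ := (Metric.tendsto_nhds.mp (tendsto_c0 x) (ε / 2)
    (half_pos hε)).exists_forall_of_atTop
  simp only [dist_zero_right] at hN₀
  filter_upwards [eventually_ge_atTop N₀] with N hN
  rw [dist_eq_norm]
  refine (norm_le_c0 (half_pos hε).le fun i => ?_).trans_lt (half_lt_self hε)
  rw [ZeroAtInftyContinuousMap.sub_apply, sum_smul_summingVector_apply]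
  split_ifs with hi
  · rw [sub_sub_cancel_left, norm_neg]
    exact (hN₀ _ hN).le
  · rw [zero_sub, norm_neg]
    exact (hN₀ _ (hN.trans (not_lt.mp hi))).le

/-- The summing basis `e₀ + ⋯ + e_k` of `c₀`, with coordinates `x k - x (k + 1)`. -/
noncomputable def summingBasis : SchauderBasis 𝕜 C₀(ℕ, 𝕜) where
  basis := summingVector
  coord k := c0Eval k - c0Eval (k + 1)
  ortho j k := by
    change (summingVector k : C₀(ℕ, 𝕜)) j - (summingVector k : C₀(ℕ, 𝕜)) (j + 1) = _
    rw [summingVector_apply, summingVector_apply, @Pi.single_apply]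
    split_ifs <;> first | omega | simp
  expansion x := by
    rw [HasSum, SummationFilter.conditional_filter_eq_map_range, tendsto_map'_iff]
    exact tendsto_sum_smul_summingVector x

end NullSequences

section Counterexample

/-- The coefficients of the Riesz products for `c₀`: their squares are not summable, but small
enough for the increments of the Riesz products to tend to zero. -/
noncomputable def c0Coeff (j : ℕ) : ℝ := invPow (1 / 2) j / 2

theorem c0Coeff_mem_Icc (j : ℕ) : c0Coeff j ∈ Icc (0 : ℝ) 1 := by
  have := invPow_nonneg (1 / 2) j
  have := invPow_le_one one_half_pos.le j
  constructor <;> rw [c0Coeff] <;> linarith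

theorem c0Coeff_sq (j : ℕ) : c0Coeff j ^ 2 = invPow 1 j / 4 := by
  rw [c0Coeff, div_pow, sq (invPow _ _), ← invPow_add]
  norm_num

theorem not_summable_c0Coeff_sq : ¬ Summable fun j => c0Coeff j ^ 2 := by
  simp_rw [c0Coeff_sq, summable_div_const_iff (four_ne_zero' ℝ), summable_invPow_iff, lt_irrefl]
  exact not_false

theorem prod_one_add_c0Coeff_sq_le (n : ℕ) :
    ∏ j ∈ Finset.range n, (1 + c0Coeff j ^ 2) ≤ √(n + 1) := by
  induction n with
  | zero => simp
  | succ n ih =>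
    have hn : (0 : ℝ) < n + 1 := by positivity
    have hinv : ((n : ℝ) + 1)⁻¹ ≤ 1 := inv_le_one_of_one_le₀ (by simp)
    have hstep : √((n : ℝ) + 1) * (1 + c0Coeff n ^ 2) ≤ √((n + 1 : ℕ) + 1) := by
      refine Real.le_sqrt_of_sq_le ?_
      rw [mul_pow, Real.sq_sqrt hn.le, c0Coeff_sq, invPow, Real.rpow_neg_one]
      calc ((n : ℝ) + 1) * (1 + ((n : ℝ) + 1)⁻¹ / 4) ^ 2
          = (n : ℝ) + 1 + 1 / 2 + ((n : ℝ) + 1)⁻¹ / 16 := by field_simp; ring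
        _ ≤ (n + 1 : ℕ) + 1 := by push_cast; linarith
    rw [Finset.prod_range_succ]
    exact (mul_le_mul_of_nonneg_right ih (by positivity)).trans hstep

theorem norm_rieszIncr_c0Coeff_le (ω : ℕ → ℝ) (n : ℕ) (t : ℝ) :
    ‖rieszIncr ω c0Coeff n t‖ ≤ invPow (1 / 4) n := by
  refine (sq_le_sq₀ (norm_nonneg _) (invPow_nonneg _ _)).mp ?_
  have hsqrt : √((n : ℝ) + 1) = invPow (-(1 / 2)) n := by rw [Real.sqrt_eq_rpow, invPow, neg_neg]
  rw [norm_rieszIncr (c0Coeff_mem_Icc n).1, mul_pow, mul_pow, sq_abs]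
  calc c0Coeff n ^ 2 * (Real.sin (ω n * t) ^ 2 * ‖riesz ω c0Coeff n t‖ ^ 2)
      ≤ invPow 1 n / 4 * (1 * invPow (-(1 / 2)) n) := by
        rw [c0Coeff_sq, ← hsqrt]
        have := invPow_nonneg 1 n
        gcongr
        · exact Real.sin_sq_le_one _
        · exact (norm_riesz_sq_le ω c0Coeff n t).trans (prod_one_add_c0Coeff_sq_le n)
    _ = invPow (1 / 4) n ^ 2 / 4 := by
        rw [one_mul, div_mul_eq_mul_div, ← invPow_add, sq, ← invPow_add]
        norm_num
    _ ≤ invPow (1 / 4) n ^ 2 := div_le_self (sq_nonneg _) (by norm_num)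

theorem tendsto_rieszIncr_c0Coeff (ω : ℕ → ℝ) (t : ℝ) :
    Tendsto (fun n => rieszIncr ω c0Coeff n t) atTop (𝓝 0) :=
  squeeze_zero_norm (fun n => norm_rieszIncr_c0Coeff_le ω n t) (tendsto_invPow (by norm_num))

/-- If the relaxed summing coordinates of the sequence of Riesz increments are those of `y ∈ c₀`,
then the Riesz products, being up to a bounded error the differences `y 0 - y N`, stay bounded. -/
theorem norm_riesz_le_of_sub_eq_relax {b : ℕ → ℝ} (hb : ∀ n, b n ∈ Icc (0 : ℝ) 1) {t : ℝ}
    (ht : 0 ≤ t) {y : C₀(ℕ, ℂ)} (hy : ∀ n, y n - y (n + 1) =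
      relax (rate n) (fun s => rieszIncr freq b n s - rieszIncr freq b (n + 1) s) t) (N : ℕ) :
    ‖riesz freq b N t‖ ≤ 2 * ‖y‖ + 11 := by
  have hstep : ∀ n, ‖rieszIncr freq b n t - (y n - y (n + 1))‖ ≤ 9 * (1 / 16) ^ n := fun n => by
    rw [hy, relax_sub _ (by fun_prop) (by fun_prop), norm_sub_rev, sub_right_comm]
    have hself := norm_relax_rieszIncr_sub_le hb ht (le_refl n)
    have hnext := norm_relax_rieszIncr_le hb ht n.lt_add_one
    have hpow : ((1 : ℝ) / 16) ^ (n + 1) ≤ (1 / 16) ^ n :=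
      pow_le_pow_of_le_one (by norm_num) (by norm_num) n.le_succ
    refine (norm_sub_le_of_le hself hnext).trans ?_
    linarith
  have hgeom : HasSum (fun n : ℕ => 9 * (1 / 16 : ℝ) ^ n) (48 / 5) := by
    have hsum :=
      (hasSum_geometric_of_lt_one (by norm_num) (by norm_num : (1 / 16 : ℝ) < 1)).mul_left 9
    norm_num1 at hsum ⊢
    exact hsum
  have herr : ‖riesz freq b N t - 1 - (y 0 - y N)‖ ≤ 48 / 5 := by
    rw [riesz_sub_one_eq_sum, ← Finset.sum_range_sub' (y ·), ← Finset.sum_sub_distrib]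
    exact (norm_sum_le_of_le _ fun n _ => hstep n).trans
      (sum_le_hasSum _ (fun n _ => by positivity) hgeom)
  have hy0N : ‖y 0 - y N‖ ≤ ‖y‖ + ‖y‖ :=
    norm_sub_le_of_le (norm_apply_le_c0 y 0) (norm_apply_le_c0 y N)
  calc ‖riesz freq b N t‖ = ‖1 + (riesz freq b N t - 1 - (y 0 - y N)) + (y 0 - y N)‖ := by
        congr 1; ring
    _ ≤ 1 + 48 / 5 + (‖y‖ + ‖y‖) :=
        norm_add_le_of_le (norm_add_le_of_le norm_one.le herr) hy0N
    _ ≤ 2 * ‖y‖ + 11 := by linarith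

theorem summable_sq_mul_sin_sq_of_norm_riesz_le {ω b : ℕ → ℝ} {t C : ℝ}
    (h : ∀ N, ‖riesz ω b N t‖ ≤ C) : Summable fun j => b j ^ 2 * Real.sin (ω j * t) ^ 2 :=
  summable_of_sum_range_le (c := C ^ 2) (fun j => by positivity) fun N => by
    have := one_add_sum_le_norm_riesz_sq ω b N t
    have := pow_le_pow_left₀ (norm_nonneg _) (h N) 2
    linarith

theorem not_maximalRegularityProperty_c0 : ¬ MaximalRegularityProperty C₀(ℕ, ℂ) := by
  refine not_maximalRegularityProperty_of_schauderBasis summingBasis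
    (f := fun t => nullSeq _ (tendsto_rieszIncr_c0Coeff freq t)) (M := 1)
    (continuous_nullSeq _ (continuous_rieszIncr freq c0Coeff) (tendsto_invPow (by norm_num))
      fun t n => norm_rieszIncr_c0Coeff_le freq n t)
    (fun t => norm_le_c0 zero_le_one fun n => (norm_rieszIncr_c0Coeff_le freq n t).trans
      (invPow_le_one (by norm_num) n)) ?_ isExponentSequence_rate
  filter_upwards [ae_not_summable_mul_sin_sq tendsto_freq (fun j => sq_nonneg (c0Coeff j))
    not_summable_c0Coeff_sq] with t hsum ht y hy
  exact hsum (summable_sq_mul_sin_sq_of_norm_riesz_le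
    (norm_riesz_le_of_sub_eq_relax c0Coeff_mem_Icc ht hy))

end Counterexample

section AbsolutelySummableSequences

open scoped lp

section Norm

variable {E : Type*} [NormedAddCommGroup E]

theorem summable_norm_l1 (x : ℓ¹(ℕ, E)) : Summable fun n => ‖x n‖ := by
  simpa using (lp.memℓp x).summable (by simp)

/-- A sequence with summable norms as an element of `ℓ¹`. -/
def l1Seq (x : ℕ → E) (hx : Summable fun n => ‖x n‖) : ℓ¹(ℕ, E) :=
  ⟨x, memℓp_gen (by simpa using hx)⟩

theorem hasSum_single_l1 (x : ℓ¹(ℕ, E)) : HasSum (fun n => lp.single 1 n (x n)) x :=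
  lp.hasSum_single ENNReal.one_ne_top x

theorem norm_single_l1 (n : ℕ) (a : E) : ‖(lp.single 1 n a : ℓ¹(ℕ, E))‖ = ‖a‖ := by
  rw [lp.norm_single one_pos]

theorem norm_le_l1 {x : ℓ¹(ℕ, E)} {u : ℕ → ℝ} {C : ℝ} (hu : HasSum u C)
    (hxu : ∀ n, ‖x n‖ ≤ u n) : ‖x‖ ≤ C :=
  (hasSum_single_l1 x).norm_le_of_bounded hu fun n => (norm_single_l1 n (x n)).trans_le (hxu n)

theorem continuous_l1 [CompleteSpace E] {Y : Type*} [TopologicalSpace Y] {x : Y → ℓ¹(ℕ, E)}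
    (hx : ∀ n, Continuous fun t => x t n) {u : ℕ → ℝ} (hu : Summable u)
    (hxu : ∀ t n, ‖x t n‖ ≤ u n) : Continuous x := by
  have hsum : x = fun t => ∑' n, lp.single 1 n (x t n) :=
    funext fun t => (hasSum_single_l1 (x t)).tsum_eq.symm
  rw [hsum]
  exact continuous_tsum (fun n => (lp.isometry_single n).continuous.comp (hx n)) hu fun n t =>
    (norm_single_l1 n (x t n)).trans_le (hxu t n)

end Norm

section DifferenceBasis

variable {𝕜 : Type*} [NontriviallyNormedField 𝕜]

/-- The vectors `e₀, e₁ - e₀, e₂ - e₁, …` of `ℓ¹`. -/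
noncomputable def differenceVector : ℕ → ℓ¹(ℕ, 𝕜)
  | 0 => lp.single 1 0 1
  | k + 1 => lp.single 1 (k + 1) 1 - lp.single 1 k 1

theorem smul_single_one (k : ℕ) (c : 𝕜) :
    c • (lp.single 1 k 1 : ℓ¹(ℕ, 𝕜)) = lp.single 1 k c := by
  rw [← lp.single_smul, smul_eq_mul, mul_one]

variable [CompleteSpace 𝕜]

/-- The tail functionals `x ↦ ∑ k, x (k + n)` on `ℓ¹`, the coordinates of `differenceBasis`. -/
noncomputable def tailSum (n : ℕ) : ℓ¹(ℕ, 𝕜) →L[𝕜] 𝕜 :=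
  lp.tsumCLM 𝕜 ℕ 𝕜 - ∑ j ∈ Finset.range n, lp.evalCLM 𝕜 (fun _ : ℕ => 𝕜) 1 j

theorem tailSum_apply (n : ℕ) (x : ℓ¹(ℕ, 𝕜)) :
    tailSum n x = (∑' j, x j) - ∑ j ∈ Finset.range n, x j := by
  simp [tailSum, lp.tsumCLM_apply, lp.evalCLM]

theorem hasSum_tailSum (n : ℕ) (x : ℓ¹(ℕ, 𝕜)) : HasSum (fun k => x (k + n)) (tailSum n x) := by
  rw [tailSum_apply, hasSum_nat_add_iff']
  exact (Summable.of_norm (summable_norm_l1 x)).hasSum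

theorem tailSum_sub_succ (n : ℕ) (x : ℓ¹(ℕ, 𝕜)) : tailSum n x - tailSum (n + 1) x = x n := by
  rw [tailSum_apply, tailSum_apply, Finset.sum_range_succ]
  ring

theorem tendsto_tailSum (x : ℓ¹(ℕ, 𝕜)) : Tendsto (fun n => tailSum n x) atTop (𝓝 0) := by
  simp_rw [← (hasSum_tailSum _ x).tsum_eq]
  exact tendsto_sum_nat_add x

theorem tailSum_single (n k : ℕ) (c : 𝕜) :
    tailSum n (lp.single 1 k c) = if n ≤ k then c else 0 := by
  rw [tailSum_apply]
  simp only [lp.coeFn_single, tsum_pi_single, Finset.sum_pi_single', Finset.mem_range]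
  split_ifs <;> first | omega | simp

theorem sum_tailSum_smul_differenceVector (x : ℓ¹(ℕ, 𝕜)) (N : ℕ) :
    ∑ k ∈ Finset.range (N + 1), tailSum k x • differenceVector k =
      ∑ k ∈ Finset.range N, lp.single 1 k (x k) + lp.single 1 N (tailSum N x) := by
  induction N with
  | zero => simp [differenceVector, smul_single_one]
  | succ N ih =>
    rw [Finset.sum_range_succ, ih, Finset.sum_range_succ, differenceVector, smul_sub,
      smul_single_one, smul_single_one, ← tailSum_sub_succ N x, lp.single_sub]
    abel

theorem tendsto_sum_tailSum_smul_differenceVector (x : ℓ¹(ℕ, 𝕜)) :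
    Tendsto (fun N => ∑ k ∈ Finset.range N, tailSum k x • differenceVector k) atTop (𝓝 x) := by
  rw [← tendsto_add_atTop_iff_nat 1]
  simp_rw [sum_tailSum_smul_differenceVector]
  have hhead := (hasSum_single_l1 x).tendsto_sum_nat
  have htail : Tendsto (fun N => (lp.single 1 N (tailSum N x) : ℓ¹(ℕ, 𝕜))) atTop (𝓝 0) := by
    rw [tendsto_zero_iff_norm_tendsto_zero]
    simp_rw [norm_single_l1]
    exact tendsto_zero_iff_norm_tendsto_zero.mp (tendsto_tailSum x)
  simpa only [add_zero] using hhead.add htail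

/-- The difference basis `e₀, e₁ - e₀, e₂ - e₁, …` of `ℓ¹`. -/
noncomputable def differenceBasis : SchauderBasis 𝕜 ℓ¹(ℕ, 𝕜) where
  basis := differenceVector
  coord := tailSum
  ortho j k := by
    rw [@Pi.single_apply]
    cases k with
    | zero => simp [differenceVector, tailSum_single]
    | succ k =>
      rw [differenceVector, map_sub, tailSum_single, tailSum_single]
      split_ifs <;> first | omega | simp
  expansion x := by
    rw [HasSum, SummationFilter.conditional_filter_eq_map_range, tendsto_map'_iff]
    exact tendsto_sum_tailSum_smul_differenceVector x

end DifferenceBasis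

section Counterexample

variable {b τ : ℕ → ℝ} (hb : ∀ n, b n ∈ Icc (0 : ℝ) 1) (hτ : Antitone τ)
  (hτ0 : Tendsto τ atTop (𝓝 0)) {R : ℝ} (hR : ∀ n t, ‖riesz freq b n t - 1‖ ≤ R)
  {x : ℝ → ℓ¹(ℕ, ℂ)} (hx : ∀ t k, x t k = (τ k - τ (k + 1)) • (riesz freq b (k + 1) t - 1))
  {t : ℝ} (ht : 0 ≤ t)
include hb hτ hτ0 hR hx ht

theorem norm_relax_tailSum_sub_le (n : ℕ) :
    ‖relax (rate n) (fun s => tailSum n (x s)) t - τ n • (riesz freq b (n + 1) t - 1)‖ ≤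
      τ n * (10 * (1 / 4) ^ n) := by
  have hw : ∀ k, 0 ≤ τ k - τ (k + 1) := fun k => sub_nonneg.mpr (hτ k.le_succ)
  have hsum : HasSum (fun k => τ (k + n) - τ (k + n + 1)) (τ n) := by
    simpa only [add_right_comm _ 1 n, zero_add] using
      hasSum_sub_succ (g := fun k => τ (k + n)) (fun i j hij => hτ (by gcongr))
        ((tendsto_add_atTop_iff_nat n).mpr hτ0)
  have hrelax : HasSum
      (fun k => (τ (k + n) - τ (k + n + 1)) •
        relax (rate n) (fun s => riesz freq b (k + n + 1) s - 1) t)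
      (relax (rate n) (fun s => tailSum n (x s)) t) := by
    simp_rw [← relax_const_smul, ← hx]
    refine hasSum_relax (fun k => ?_) (hsum.mul_right R).summable (fun k s => ?_)
      (fun s => hasSum_tailSum n (x s)) t
    · simp_rw [hx]
      fun_prop
    · rw [hx, norm_smul, Real.norm_of_nonneg (hw _)]
      exact mul_le_mul_of_nonneg_left (hR _ s) (hw _)
  refine (hrelax.sub (hsum.smul_const (riesz freq b (n + 1) t - 1))).norm_le_of_bounded
    (hsum.mul_right (10 * (1 / 4) ^ n)) fun k => ?_
  rw [← smul_sub, norm_smul, Real.norm_of_nonneg (hw _)]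
  exact mul_le_mul_of_nonneg_left (norm_relax_riesz_sub_le hb ht (by omega)) (hw _)

theorem summable_mul_norm_rieszIncr {y : ℓ¹(ℕ, ℂ)}
    (hy : ∀ n, tailSum n y = relax (rate n) (fun s => tailSum n (x s)) t) :
    Summable fun n => τ n * ‖rieszIncr freq b n t‖ := by
  have herr : ∀ n, ‖tailSum n y - τ n • (riesz freq b (n + 1) t - 1)‖ ≤
      τ 0 * (10 * (1 / 4) ^ n) := fun n => by
    rw [hy]
    exact (norm_relax_tailSum_sub_le hb hτ hτ0 hR hx ht n).trans
      (mul_le_mul_of_nonneg_right (hτ n.zero_le) (by positivity))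
  have hgeom : Summable fun n : ℕ => τ 0 * (10 * (1 / 4 : ℝ) ^ n) :=
    ((summable_geometric_of_lt_one (by norm_num) (by norm_num)).mul_left 10).mul_left (τ 0)
  rw [← summable_nat_add_iff 1]
  refine (((summable_norm_l1 (x t)).add (summable_norm_l1 y)).add
    (hgeom.add ((summable_nat_add_iff 1).mpr hgeom))).of_nonneg_of_le
    (fun n => mul_nonneg (hτ.le_of_tendsto hτ0 _) (norm_nonneg _)) fun n => ?_
  have hsplit : τ (n + 1) • rieszIncr freq b (n + 1) t = x t n - y n +
      ((tailSum n y - τ n • (riesz freq b (n + 1) t - 1)) -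
        (tailSum (n + 1) y - τ (n + 1) • (riesz freq b (n + 1 + 1) t - 1))) := by
    rw [hx, ← tailSum_sub_succ n y, rieszIncr]
    simp only [Complex.real_smul, Complex.ofReal_sub]
    ring
  rw [← Real.norm_of_nonneg (hτ.le_of_tendsto hτ0 (n + 1)), ← norm_smul, hsplit]
  exact norm_add_le_of_le (norm_sub_le _ _) (norm_sub_le_of_le (herr n) (herr (n + 1)))

theorem summable_mul_sin_sq_of_tailSum_eq_relax {y : ℓ¹(ℕ, ℂ)}
    (hy : ∀ n, tailSum n y = relax (rate n) (fun s => tailSum n (x s)) t) :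
    Summable fun n => τ n * b n * Real.sin (freq n * t) ^ 2 := by
  have hτ_nonneg := hτ.le_of_tendsto hτ0
  refine (summable_mul_norm_rieszIncr hb hτ hτ0 hR hx ht hy).of_nonneg_of_le
    (fun n => mul_nonneg (mul_nonneg (hτ_nonneg n) (hb n).1) (sq_nonneg _)) fun n => ?_
  have hriesz : 1 ≤ ‖riesz freq b n t‖ := one_le_norm_riesz freq b n t
  have hsin : Real.sin (freq n * t) ^ 2 ≤ |Real.sin (freq n * t)| := by
    rw [← sq_abs]
    exact pow_le_of_le_one (abs_nonneg _) (Real.abs_sin_le_one _) two_ne_zero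
  rw [norm_rieszIncr (hb n).1, mul_assoc]
  exact mul_le_mul_of_nonneg_left (mul_le_mul_of_nonneg_left
    (hsin.trans (le_mul_of_one_le_right (abs_nonneg _) hriesz)) (hb n).1) (hτ_nonneg n)

end Counterexample

theorem norm_riesz_sub_one_le_of_summable_sq {b : ℕ → ℝ} (hb : Summable fun j => b j ^ 2)
    (ω : ℕ → ℝ) (n : ℕ) (t : ℝ) : ‖riesz ω b n t - 1‖ ≤ √(Real.exp (∑' j, b j ^ 2)) + 1 := by
  refine norm_sub_le_of_le (Real.le_sqrt_of_sq_le ?_) norm_one.le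
  calc ‖riesz ω b n t‖ ^ 2 ≤ ∏ j ∈ Finset.range n, (1 + b j ^ 2) := norm_riesz_sq_le ω b n t
    _ ≤ Real.exp (∑ j ∈ Finset.range n, b j ^ 2) :=
        Real.prod_one_add_le_exp_sum _ fun j => sq_nonneg (b j)
    _ ≤ Real.exp (∑' j, b j ^ 2) :=
        Real.exp_le_exp.mpr (hb.sum_le_tsum _ fun j _ => sq_nonneg (b j))

theorem not_maximalRegularityProperty_l1 : ¬ MaximalRegularityProperty ℓ¹(ℕ, ℂ) := by
  have hb : ∀ n, invPow (3 / 4) n ∈ Icc (0 : ℝ) 1 := fun n =>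
    ⟨invPow_nonneg _ n, invPow_le_one (by norm_num) n⟩
  have hτ : Antitone (invPow (1 / 4)) := antitone_invPow (by norm_num)
  have hτ0 : Tendsto (invPow (1 / 4)) atTop (𝓝 0) := tendsto_invPow (by norm_num)
  have hb2 : Summable fun j => invPow (3 / 4) j ^ 2 := by
    simp_rw [sq, ← invPow_add]
    exact summable_invPow_iff.mpr (by norm_num)
  have hR := norm_riesz_sub_one_le_of_summable_sq hb2 freq
  have hτb : ¬ Summable fun k => invPow (1 / 4) k * invPow (3 / 4) k := by
    simp_rw [← invPow_add]
    exact summable_invPow_iff.not.mpr (by norm_num)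
  set R := √(Real.exp (∑' j, invPow (3 / 4) j ^ 2)) + 1
  have hsum := (hasSum_sub_succ hτ hτ0).mul_right R
  have hbound : ∀ t k, ‖(invPow (1 / 4) k - invPow (1 / 4) (k + 1)) •
      (riesz freq (invPow (3 / 4)) (k + 1) t - 1)‖ ≤
        (invPow (1 / 4) k - invPow (1 / 4) (k + 1)) * R := fun t k => by
    rw [norm_smul, Real.norm_of_nonneg (sub_nonneg.mpr (hτ k.le_succ))]
    exact mul_le_mul_of_nonneg_left (hR _ t) (sub_nonneg.mpr (hτ k.le_succ))
  refine not_maximalRegularityProperty_of_schauderBasis differenceBasis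
    (f := fun t => l1Seq _ (hsum.summable.of_nonneg_of_le (fun k => norm_nonneg _) (hbound t)))
    (continuous_l1 (fun k => ?_) hsum.summable hbound)
    (fun t => norm_le_l1 hsum (hbound t)) ?_ isExponentSequence_rate
  · simp only [l1Seq]
    fun_prop
  · filter_upwards [ae_not_summable_mul_sin_sq tendsto_freq
      (fun k => mul_nonneg (invPow_nonneg (1 / 4) k) (hb k).1) hτb] with t hdiv ht y hy
    exact hdiv (summable_mul_sin_sq_of_tailSum_eq_relax hb hτ hτ0 hR (fun _ _ => rfl) ht hy)

end AbsolutelySummableSequences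

end MaximalRegularity

theorem corollary3p2 :
    ¬ MaximalRegularity.MaximalRegularityProperty C₀(ℕ, ℂ) ∧
      ¬ MaximalRegularity.MaximalRegularityProperty (lp (fun _ : ℕ => ℂ) 1) :=
  ⟨MaximalRegularity.not_maximalRegularityProperty_c0,
    MaximalRegularity.not_maximalRegularityProperty_l1⟩
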